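/- Let $n$ be a non-negative integer, let $w=(w_0,\ldots,w_n)$ be an $(n+1)$-tuple of positive integers, put $|w|=w_0+w_1+\cdots+w_n$, and assume $|w|\ge 2$ (that is, exclude only the case $n=0$, $w_0=1$). Let $K$ be a number field with ring of integers $\mathcal{O}_K$. Let $r_1$, $r_2$, $d_K$, $h_K$, $R_K$, $\mu_K$ and $\zeta_K$ be the number of real places, number of non-real complex places, discriminant, class number, regulator, number of roots of unity and Dedekind zeta function of $K$, respectively. Let $\mathbb{P}(w)(K)=K^\times\backslash(K^{n+1}\setminus\{0\})$, where $\lambda\in K^\times$ acts by $(x_0,\ldots,x_n)\mapsto(\lambda^{w_0}x_0,\ldots,\lambda^{w_n}x_n)$. For $x\in K^{n+1}\setminus\{0\}$, let $\mathcal{I}_w(x)$ be the intersection of all fractional ideals $\mathfrak{a}$ of $\mathcal{O}_K$ such that $x\in\mathfrak{a}^{w_0}\times\cdots\times\mathfrak{a}^{w_n}$, and define the size of the class $[x]\in\mathbb{P}(w)(K)$ by $$S_{w,K}([x])=\mathrm{N}(\mathcal{I}_w(x))^{-1}\prod_{v\mid\infty}\max_{0\le i\le n}|x_i|_v^{1/w_i},$$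 where $v$ ranges over the Archimedean places of $K$ and $|\cdot|_v$ is the normalized absolute value at $v$ (the usual absolute value if $v$ is real, its square if $v$ is complex); this does not depend on the choice of the representative $x$. Put $$\mu_K^w=\frac{\mu_K}{\gcd\{w_0,w_1,\ldots,w_n,\mu_K\}},\qquad C_K^w=\frac{h_K R_K}{\mu_K^w\,\zeta_K(|w|)}\left(\frac{2^{r_1}(2\pi)^{r_2}}{\sqrt{|d_K|}}\right)^{n+1}|w|^{r_1+r_2-1}.$$ Then for every real $T$ the set $\{x\in\mathbb{P}(w)(K)\mid S_{w,K}(x)\le T\}$ is finite, and $$\#\{x\in\mathbb{P}(w)(K)\mid S_{w,K}(x)\le T\}\sim C_K^w\,T^{|w|}\quad\text{as }T\to\infty.$$ -/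

import Mathlib

open NumberField Filter Asymptotics
open scoped nonZeroDivisors

noncomputable section

namespace WeightedProjective

variable {n : ℕ} (w : Fin (n + 1) → ℕ+) (K : Type*) [Field K]

/-- The nonzero vectors in `K ^ (n + 1)`. -/
abbrev NonzeroVec (n : ℕ) (K : Type*) [Field K] : Type _ := {x : Fin (n + 1) → K // x ≠ 0}

/-- Two nonzero vectors are equivalent if they lie in the same orbit of the weighted action
`c • (x₀, …, xₙ) = (c ^ w₀ * x₀, …, c ^ wₙ * xₙ)` of the group `Kˣ`. -/
def orbitSetoid : Setoid (NonzeroVec n K) where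
  r x y := ∃ c : Kˣ, ∀ i, y.1 i = (c : K) ^ (w i : ℕ) * x.1 i
  iseqv :=
    { refl := fun x => ⟨1, fun i => by simp⟩
      symm := by
        rintro x y ⟨c, hc⟩
        refine ⟨c⁻¹, fun i => ?_⟩
        rw [hc i, ← mul_assoc, ← mul_pow]
        simp
      trans := by
        rintro x y z ⟨c, hc⟩ ⟨d, hd⟩
        refine ⟨d * c, fun i => ?_⟩
        rw [hd i, hc i, ← mul_assoc, ← mul_pow]
        simp }

/-- The set `P(w)(K)` of `K`-points of the weighted projective space with weights `w`, that is,
the quotient of `K ^ (n + 1) ∖ {0}` by the weighted action of `Kˣ`. -/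
def Point : Type _ := Quotient (orbitSetoid w K)

variable {K} [NumberField K]

/-- The principal fractional ideal generated by the inverse of a common denominator of the
coordinates of `x` satisfies the condition defining the scaling ideal. -/
theorem exists_scaling (x : Fin (n + 1) → K) :
    ∃ a : FractionalIdeal (𝓞 K)⁰ K, ∀ i, x i ∈ a ^ (w i : ℕ) := by
  obtain ⟨b, hb⟩ := IsLocalization.exist_integer_multiples_of_finite (𝓞 K)⁰ x
  have hb0 : algebraMap (𝓞 K) K b ≠ 0 := by
    simp
  refine ⟨FractionalIdeal.spanSingleton _ (algebraMap (𝓞 K) K b)⁻¹, fun i => ?_⟩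
  rw [FractionalIdeal.spanSingleton_pow, FractionalIdeal.mem_spanSingleton]
  obtain ⟨y, hy⟩ := hb i
  obtain ⟨m, hm⟩ : ∃ m : ℕ, (w i : ℕ) = m + 1 := ⟨_, (Nat.succ_pred_eq_of_pos (w i).pos).symm⟩
  refine ⟨(b : 𝓞 K) ^ m * y, ?_⟩
  rw [Algebra.smul_def, map_mul, map_pow, hy, hm, Algebra.smul_def, inv_pow]
  field_simp
  ring

/-- The scaling ideal of `x`: the intersection of all fractional ideals `a` of `𝓞 K` such that
`x i ∈ a ^ (w i)` for all `i`. -/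
def scalingIdeal (x : Fin (n + 1) → K) : FractionalIdeal (𝓞 K)⁰ K :=
  ⟨⨅ a : {a : FractionalIdeal (𝓞 K)⁰ K // ∀ i, x i ∈ a ^ (w i : ℕ)},
      ((a : FractionalIdeal (𝓞 K)⁰ K) : Submodule (𝓞 K) K), by
    obtain ⟨a, ha⟩ := exists_scaling w x
    exact FractionalIdeal.isFractional_of_le
      (iInf_le (fun a : {a : FractionalIdeal (𝓞 K)⁰ K // ∀ i, x i ∈ a ^ (w i : ℕ)} =>
        ((a : FractionalIdeal (𝓞 K)⁰ K) : Submodule (𝓞 K) K)) ⟨a, ha⟩)⟩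

/-- The Archimedean size of `x`: the product over the Archimedean places `v` of the maximum of
`|x i|_v ^ (1 / w i)`, where `|y|_v = (v y) ^ v.mult` is the normalized absolute value. -/
def archSize (x : Fin (n + 1) → K) : ℝ :=
  ∏ v : InfinitePlace K, ⨆ i, ((v (x i)) ^ v.mult) ^ (1 / ((w i : ℕ) : ℝ))

/-- The size of a nonzero vector. -/
def vecSize (x : NonzeroVec n K) : ℝ :=
  ((FractionalIdeal.absNorm (scalingIdeal w x.1) : ℚ) : ℝ)⁻¹ * archSize w x.1

theorem le_scalingIdeal_iff (x : Fin (n + 1) → K) (J : FractionalIdeal (𝓞 K)⁰ K) :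
    J ≤ scalingIdeal w x ↔
      ∀ a : FractionalIdeal (𝓞 K)⁰ K, (∀ i, x i ∈ a ^ (w i : ℕ)) → J ≤ a := by
  rw [← FractionalIdeal.coe_le_coe]
  change (J : Submodule (𝓞 K) K) ≤ ⨅ _, _ ↔ _
  rw [le_iInf_iff]
  exact ⟨fun h a ha => h ⟨a, ha⟩, fun h a => h a.1 a.2⟩

theorem mem_smul_iff (c : Kˣ) (m : ℕ) (y : K) (a : FractionalIdeal (𝓞 K)⁰ K) :
    (c : K) ^ m * y ∈ a ^ m ↔
      y ∈ (FractionalIdeal.spanSingleton (𝓞 K)⁰ ((c : K)⁻¹) * a) ^ m := by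
  rw [mul_pow, FractionalIdeal.spanSingleton_pow, FractionalIdeal.mem_singleton_mul]
  constructor
  · intro h
    refine ⟨_, h, ?_⟩
    rw [inv_pow]
    field_simp
  · rintro ⟨z, hz, rfl⟩
    convert! hz using 1
    rw [inv_pow]
    field_simp

theorem scalingIdeal_smul (c : Kˣ) (x y : Fin (n + 1) → K)
    (h : ∀ i, y i = (c : K) ^ (w i : ℕ) * x i) :
    scalingIdeal w y = FractionalIdeal.spanSingleton (𝓞 K)⁰ (c : K) * scalingIdeal w x := by
  have hc : FractionalIdeal.spanSingleton (𝓞 K)⁰ (c : K) *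
      FractionalIdeal.spanSingleton (𝓞 K)⁰ ((c : K)⁻¹) = 1 := by
    simp [FractionalIdeal.spanSingleton_mul_spanSingleton]
  have key : ∀ p q I J : FractionalIdeal (𝓞 K)⁰ K, p * q = 1 → (p * I ≤ J ↔ I ≤ q * J) := by
    intro p q I J hpq
    constructor
    · intro h
      have := mul_le_mul_right h q
      rwa [← mul_assoc, mul_comm q, hpq, one_mul] at this
    · intro h
      have := mul_le_mul_right h p
      rwa [← mul_assoc, hpq, one_mul] at this
  have key' : ∀ I J : FractionalIdeal (𝓞 K)⁰ K,
      FractionalIdeal.spanSingleton (𝓞 K)⁰ ((c : K)⁻¹) * I ≤ J ↔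
        I ≤ FractionalIdeal.spanSingleton (𝓞 K)⁰ (c : K) * J :=
    fun I J => key _ _ I J (by rw [mul_comm, hc])
  refine eq_of_forall_le_iff fun J => ?_
  rw [← key', le_scalingIdeal_iff, le_scalingIdeal_iff]
  constructor
  · intro H a ha
    rw [key']
    refine H _ fun i => ?_
    rw [h i, mem_smul_iff, ← mul_assoc, mul_comm (FractionalIdeal.spanSingleton _ _), hc, one_mul]
    exact ha i
  · intro H a ha
    have := H (FractionalIdeal.spanSingleton (𝓞 K)⁰ ((c : K)⁻¹) * a) fun i => by
      rw [← mem_smul_iff, ← h i]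
      exact ha i
    rwa [key', ← mul_assoc, hc, one_mul] at this

theorem archSize_smul (c : Kˣ) (x y : Fin (n + 1) → K)
    (h : ∀ i, y i = (c : K) ^ (w i : ℕ) * x i) :
    archSize w y = |((Algebra.norm ℚ (c : K) : ℚ) : ℝ)| * archSize w x := by
  have := InfinitePlace.prod_eq_abs_norm (c : K)
  push_cast at this
  rw [← this, archSize, archSize, ← Finset.prod_mul_distrib]
  refine Finset.prod_congr rfl fun v _ => ?_
  rw [Real.mul_iSup_of_nonneg (by positivity)]
  refine congrArg _ (funext fun i => ?_)
  have hw : ((w i : ℕ) : ℝ) ≠ 0 := by exact_mod_cast (w i).ne_zero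
  rw [h i, map_mul, map_pow, mul_pow, Real.mul_rpow (by positivity) (by positivity), ← pow_mul,
    mul_comm (w i : ℕ), pow_mul, ← Real.rpow_natCast _ (w i : ℕ),
    ← Real.rpow_mul (by positivity), mul_one_div_cancel hw, Real.rpow_one]

theorem vecSize_eq_of_rel (x y : NonzeroVec n K) (h : (orbitSetoid w K).r x y) :
    vecSize w x = vecSize w y := by
  obtain ⟨c, hc⟩ := h
  have hN : ((Algebra.norm ℚ (c : K) : ℚ) : ℝ) ≠ 0 := by
    exact_mod_cast (Algebra.norm_ne_zero_iff.mpr c.ne_zero)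
  rw [vecSize, vecSize, scalingIdeal_smul w c x.1 y.1 hc, archSize_smul w c x.1 y.1 hc, map_mul,
    FractionalIdeal.absNorm_span_singleton]
  push_cast
  field_simp

/-- The size function `S_{w,K}` on `P(w)(K)`, sending the class of `x` to
`N(scalingIdeal w x)⁻¹ * archSize w x`. -/
def size : Point w K → ℝ := Quotient.lift (vecSize w) (vecSize_eq_of_rel w)

/-- The sum `|w|` of the weights. -/
def weightSum : ℕ := ∑ i, (w i : ℕ)

variable (K)

/-- The number `μ_K / gcd {w₀, …, wₙ, μ_K}`, where `μ_K` is the number of roots of unity in `K`.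
The division of natural numbers is exact. -/
def rootFactor : ℕ :=
  Units.torsionOrder K /
    Nat.gcd (Finset.univ.gcd fun i => (w i : ℕ)) (Units.torsionOrder K)

/-- The value of the Dedekind zeta function of `K` at a natural number `s`. Its Dirichlet series
has real coefficients, so that for `2 ≤ s` it is a real number, equal to its real part. -/
def zetaValue (s : ℕ) : ℝ := (dedekindZeta K (s : ℂ)).re

/-- The constant `C_K^w`. -/
def countConst : ℝ :=
  (classNumber K * Units.regulator K) / (rootFactor w K * zetaValue K (weightSum w)) *
    ((2 ^ InfinitePlace.nrRealPlaces K * (2 * Real.pi) ^ InfinitePlace.nrComplexPlaces K) /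
      √|(discr K : ℝ)|) ^ (n + 1) *
    (weightSum w : ℝ) ^ (InfinitePlace.nrRealPlaces K + InfinitePlace.nrComplexPlaces K - 1)

end WeightedProjective

end

/-! Instead of counting points directly, count pairs `(b, p)` of a nonzero integral ideal `b` and a
point `p` with `N(b) * size p ≤ X`, and recover the points by Möbius inversion. The scaling ideal of
a vector is attained: it is invertible and is the least ideal `a` with `x i ∈ a ^ w i` for all `i`
(`exists_unit_eq_scalingIdeal`). Fix a representative `a_C` of each ideal class. A pair `(b, p)`
then has a lift `x` of `p` with scaling ideal `a_C * b` for exactly one class `C`, and this lift is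
unique up to units of `𝓞 K`. Letting `b` vary, the coprimality condition disappears: what remains is
`x i ∈ a_C ^ w i` and a bound on the Archimedean size. Requiring the weighted norms to lie in the
fundamental cone cuts the unit group down to roots of unity, whose orbits have `rootFactor` elements
when no coordinate vanishes. Vectors with a zero coordinate are negligible.

The vectors are points of a product of lattices in a weighted dilate of a bounded region, and
`tendsto_ncard_gridSet` counts them: rounding to the lattice converges to the identity, so the
volume of the rounded region, which is exactly a count times a cell volume, converges when the
boundary is null.

For the volume, raise the weighted norms to the power `|w|`. On boxes the measure of the preimage is
a constant times the volume of the same box in one mixed space (`volume_setOf_weightedNorm_pow_lt`),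
because the exponents `w i / |w|` add up to one; hence this holds on all norm-invariant measurable
sets. The power dilates the logarithmic fundamental domain by `|w|`, so the region corresponds to
`|w| ^ rank` unit translates of the standard one; this is the origin of `|w| ^ (r₁ + r₂ - 1)`.

Finally the number of pairs is the sum over `b` of the number of points of size at most `X / N(b)`,
and `tendsto_div_zetaValue` divides the asymptotics by `ζ_K(|w|)`. -/

noncomputable section

namespace WeightedProjective

/-! ### Lattice points in weighted dilates of a region -/

section LatticeCount

open MeasureTheory Topology Module

variable {V : Type*} [NormedAddCommGroup V] [NormedSpace ℝ V]

/-- Identifies the cells of the floor map with translates of the fundamental domain, which makes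
them measurable and of known volume. -/
theorem floor_smul_eq_iff {κ : Type*} [Fintype κ] (b : Basis κ ℝ V) {l : V}
    (hl : l ∈ Submodule.span ℤ (Set.range b)) (z : V) :
    (ZSpan.floor b z : V) = l ↔ z - l ∈ ZSpan.fundamentalDomain b := by
  constructor
  · rintro rfl
    exact ZSpan.fract_mem_fundamentalDomain b z
  · intro h
    have h1 := (ZSpan.fract_eq_self (b := b)).mpr h
    have h2 := ZSpan.fract_add_ZSpan b (z - l) hl
    rw [sub_add_cancel, h1, ZSpan.fract_apply] at h2
    exact sub_right_injective h2

variable {m : ℕ} {κ : Fin m → Type*} [∀ i, Fintype (κ i)] (b : ∀ i, Basis (κ i) ℝ V)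
  (w : Fin m → ℕ)

/-- The point of the weighted dilate by `t⁻¹` of a product of lattices that corresponds to the cell
containing `x`. -/
def gridPoint (t : ℝ) (x : Fin m → V) : Fin m → V :=
  fun i => (t ^ w i)⁻¹ • (ZSpan.floor (b i) (t ^ w i • x i) : V)

/-- The points of a product of lattices whose weighted dilate by `t⁻¹` lies in `s`. -/
def gridSet (s : Set (Fin m → V)) (t : ℝ) : Set (Fin m → V) :=
  {l | (∀ i, l i ∈ Submodule.span ℤ (Set.range (b i))) ∧ (fun i => (t ^ w i)⁻¹ • l i) ∈ s}

theorem norm_gridPoint_sub_le {t : ℝ} (ht : 0 < t) (x : Fin m → V) (i : Fin m) :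
    ‖x i - gridPoint b w t x i‖ ≤ (t ^ w i)⁻¹ * ∑ j, ‖b i j‖ := by
  have h0 : t ^ w i ≠ 0 := by positivity
  have : x i - gridPoint b w t x i = (t ^ w i)⁻¹ • ZSpan.fract (b i) (t ^ w i • x i) := by
    rw [ZSpan.fract_apply, smul_sub, inv_smul_smul₀ h0]
    rfl
  rw [this, norm_smul, norm_inv, Real.norm_of_nonneg (by positivity)]
  gcongr
  exact ZSpan.norm_fract_le (b i) _

theorem tendsto_gridPoint (hw : ∀ i, 0 < w i) (x : Fin m → V) :
    Tendsto (fun t => gridPoint b w t x) atTop (𝓝 x) := by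
  rw [tendsto_pi_nhds]
  intro i
  have h1 : Tendsto (fun t : ℝ => (t ^ w i)⁻¹ * ∑ j, ‖b i j‖) atTop (𝓝 0) := by
    simpa using ((tendsto_pow_atTop (hw i).ne').inv_tendsto_atTop).mul_const (∑ j, ‖b i j‖)
  rw [tendsto_iff_norm_sub_tendsto_zero]
  refine squeeze_zero' (.of_forall fun _ => norm_nonneg _) ?_ h1
  filter_upwards [eventually_gt_atTop 0] with t ht
  rw [norm_sub_rev]
  exact norm_gridPoint_sub_le b w ht x i

/-- `gridPoint` is constant on products of cells, so the preimage splits according to the lattice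
vector of the cell. -/
theorem preimage_gridPoint_eq (s : Set (Fin m → V)) (t : ℝ) :
    gridPoint b w t ⁻¹' s = ⋃ l ∈ gridSet b w s t,
      Set.univ.pi fun i => {y : V | (ZSpan.floor (b i) (t ^ w i • y) : V) = l i} := by
  ext x
  simp only [Set.mem_preimage, Set.mem_iUnion, Set.mem_pi, Set.mem_univ, forall_const,
    exists_prop]
  constructor
  · intro h
    exact ⟨fun i => (ZSpan.floor (b i) (t ^ w i • x i) : V), ⟨fun i => Subtype.prop _, h⟩,
      fun i => rfl⟩
  · rintro ⟨l, ⟨hl, hls⟩, h⟩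
    have : gridPoint b w t x = fun i => (t ^ w i)⁻¹ • l i := funext fun i => by
      rw [← h i]; rfl
    rwa [this]

section

variable [MeasureSpace V] [BorelSpace V]

theorem measurableSet_floor_cell {κ : Type*} [Fintype κ] (b : Basis κ ℝ V) {l : V}
    (hl : l ∈ Submodule.span ℤ (Set.range b)) (c : ℝ) :
    MeasurableSet {y : V | (ZSpan.floor b (c • y) : V) = l} := by
  simp_rw [floor_smul_eq_iff b hl]
  exact measurableSet_preimage (by fun_prop) (ZSpan.fundamentalDomain_measurableSet b)

end

variable [FiniteDimensional ℝ V]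

theorem finite_gridSet {s : Set (Fin m → V)} (hs : Bornology.IsBounded s) {t : ℝ} (ht : 0 < t) :
    (gridSet b w s t).Finite := by
  obtain ⟨R, hR⟩ := hs.exists_norm_le
  refine (Set.Finite.pi' (t := fun i => Metric.closedBall (0 : V) (t ^ w i * R) ∩
    (Submodule.span ℤ (Set.range (b i)) : Set V)) fun i => ?_).subset ?_
  · exact ZSpan.setFinite_inter _ Metric.isBounded_closedBall
  · rintro l ⟨hl, hls⟩ i
    refine ⟨?_, hl i⟩
    have h1 := (norm_le_pi_norm _ i).trans (hR _ hls)
    rw [norm_smul, norm_inv, Real.norm_of_nonneg (by positivity), inv_mul_le_iff₀ (by positivity)]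
      at h1
    simpa using h1

variable [MeasureSpace V] [BorelSpace V]

theorem measurableSet_preimage_gridPoint {s : Set (Fin m → V)} (hs : Bornology.IsBounded s)
    {t : ℝ} (ht : 0 < t) : MeasurableSet (gridPoint b w t ⁻¹' s) := by
  rw [preimage_gridPoint_eq b w s t]
  exact (finite_gridSet b w hs ht).measurableSet_biUnion fun l hl =>
    MeasurableSet.univ_pi fun i => measurableSet_floor_cell (b i) (hl.1 i) _

variable [(volume : Measure V).IsAddHaarMeasure]

theorem volume_floor_cell {κ : Type*} [Fintype κ] (b : Basis κ ℝ V) {l : V}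
    (hl : l ∈ Submodule.span ℤ (Set.range b)) {c : ℝ} (hc : 0 < c) :
    volume {y : V | (ZSpan.floor b (c • y) : V) = l} =
      ENNReal.ofReal ((c ^ finrank ℝ V)⁻¹) * volume (ZSpan.fundamentalDomain b) := by
  simp_rw [floor_smul_eq_iff b hl]
  have : {y : V | c • y - l ∈ ZSpan.fundamentalDomain b} =
      (fun y => c • y) ⁻¹' ((fun z => z - l) ⁻¹' ZSpan.fundamentalDomain b) := rfl
  simp_rw [this, Measure.addHaar_preimage_smul _ hc.ne', sub_eq_add_neg]
  rw [measure_preimage_add_right, abs_of_pos (by positivity)]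

/-- All cells are congruent and disjoint, so the count is encoded exactly in a volume, without
boundary error. -/
theorem volume_preimage_gridPoint {s : Set (Fin m → V)} (hs : Bornology.IsBounded s)
    {t : ℝ} (ht : 0 < t) :
    volume (gridPoint b w t ⁻¹' s) = (gridSet b w s t).ncard *
      ∏ i, (ENNReal.ofReal (((t ^ w i) ^ finrank ℝ V)⁻¹) *
        volume (ZSpan.fundamentalDomain (b i))) := by
  have hfin := finite_gridSet b w hs ht
  rw [preimage_gridPoint_eq b w s t, ← hfin.coe_toFinset, Set.ncard_coe_finset]
  simp only [Finset.mem_coe]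
  rw [measure_biUnion_finset]
  · rw [Finset.sum_congr rfl (g := fun _ => ∏ i, (ENNReal.ofReal (((t ^ w i) ^ finrank ℝ V)⁻¹) *
        volume (ZSpan.fundamentalDomain (b i)))), Finset.sum_const, nsmul_eq_mul]
    intro l hl
    rw [hfin.mem_toFinset] at hl
    rw [volume_pi_pi]
    exact Finset.prod_congr rfl fun i _ => volume_floor_cell (b i) (hl.1 i) (by positivity)
  · intro l _ l' _ hne
    rw [Function.onFun, Set.disjoint_left]
    intro x hx hx'
    refine hne (funext fun i => ?_)
    rw [← hx i trivial, ← hx' i trivial]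
  · intro l hl
    rw [hfin.mem_toFinset] at hl
    exact MeasurableSet.univ_pi fun i => measurableSet_floor_cell (b i) (hl.1 i) _

/-- Dominated convergence for indicators: `gridPoint b w t x` tends to `x`, so membership in `s`
stabilises for every `x` off the frontier. -/
theorem tendsto_volume_preimage_gridPoint (hw : ∀ i, 0 < w i) {s : Set (Fin m → V)}
    (hs : Bornology.IsBounded s) (hsm : MeasurableSet s) (hfr : volume (frontier s) = 0) :
    Tendsto (fun t => volume (gridPoint b w t ⁻¹' s)) atTop (𝓝 (volume s)) := by
  obtain ⟨R, hR⟩ := hs.exists_norm_le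
  -- Replacing `t` by `max t 1` gives measurability for every `t` and one ball containing all the
  -- preimages, since the rounding error is largest at `t = 1`.
  have key := tendsto_measure_of_ae_tendsto_indicator (μ := (volume : Measure (Fin m → V)))
    (L := atTop) (As := fun t : ℝ => gridPoint b w (max t 1) ⁻¹' s) (A := s) hsm
    (fun t => measurableSet_preimage_gridPoint b w hs (by positivity))
    (B := Metric.closedBall 0 (R + ∑ i, ∑ j, ‖b i j‖)) Metric.isClosed_closedBall.measurableSet
    measure_closedBall_lt_top.ne ?_ ?_
  · refine key.congr' ?_
    filter_upwards [eventually_ge_atTop 1] with t ht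
    rw [max_eq_left ht]
  · refine .of_forall fun t x hx => ?_
    have ht : (1 : ℝ) ≤ max t 1 := le_max_right _ _
    have hnn : (0 : ℝ) ≤ ∑ i, ∑ j, ‖b i j‖ :=
      Finset.sum_nonneg fun i _ => Finset.sum_nonneg fun j _ => norm_nonneg _
    rw [mem_closedBall_zero_iff, pi_norm_le_iff_of_nonneg
      (add_nonneg ((norm_nonneg _).trans (hR _ hx)) hnn)]
    intro i
    have h1 := norm_gridPoint_sub_le b w (zero_lt_one.trans_le ht) x i
    have h2 := (norm_le_pi_norm _ i).trans (hR _ hx)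
    have h3 : ((max t 1) ^ w i)⁻¹ * ∑ j, ‖b i j‖ ≤ ∑ j, ‖b i j‖ :=
      mul_le_of_le_one_left (Finset.sum_nonneg fun j _ => norm_nonneg _)
        (inv_le_one_of_one_le₀ (one_le_pow₀ ht))
    have h4 : ∑ j, ‖b i j‖ ≤ ∑ i, ∑ j, ‖b i j‖ :=
      Finset.single_le_sum (f := fun i => ∑ j, ‖b i j‖)
        (fun i _ => Finset.sum_nonneg fun j _ => norm_nonneg _) (Finset.mem_univ i)
    have h5 := norm_add_le (x i - gridPoint b w (max t 1) x i) (gridPoint b w (max t 1) x i)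
    rw [sub_add_cancel] at h5
    linarith
  · have hnull : ∀ᵐ x ∂(volume : Measure (Fin m → V)), x ∉ frontier s :=
      measure_eq_zero_iff_ae_notMem.mp hfr
    filter_upwards [hnull] with x hx
    have hT : Tendsto (fun t => gridPoint b w (max t 1) x) atTop (𝓝 x) := by
      refine (tendsto_gridPoint b w hw x).congr' ?_
      filter_upwards [eventually_ge_atTop 1] with t ht
      rw [max_eq_left ht]
    by_cases hxs : x ∈ s
    · have : s ∈ 𝓝 x := by
        by_contra h
        exact hx ⟨subset_closure hxs, fun h' => h (mem_interior_iff_mem_nhds.mp h')⟩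
      filter_upwards [hT.eventually_mem this] with t ht
      exact iff_of_true ht hxs
    · have : sᶜ ∈ 𝓝 x := by
        by_contra h
        rw [← frontier_compl] at hx
        exact hx ⟨subset_closure hxs, fun h' => h (mem_interior_iff_mem_nhds.mp h')⟩
      filter_upwards [hT.eventually_mem this] with t ht
      exact iff_of_false ht hxs

/-- The number of points of a product of lattices in a weighted dilate of `s` is asymptotic to the
volume of the dilate divided by the product of the covolumes. -/
theorem tendsto_ncard_gridSet (hw : ∀ i, 0 < w i) {s : Set (Fin m → V)}
    (hs : Bornology.IsBounded s) (hsm : MeasurableSet s) (hfr : volume (frontier s) = 0) :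
    Tendsto (fun t : ℝ => ((gridSet b w s t).ncard : ℝ) / (t ^ finrank ℝ V) ^ ∑ i, w i) atTop
      (𝓝 (volume.real s / ∏ i, volume.real (ZSpan.fundamentalDomain (b i)))) := by
  have hfin : volume s ≠ ⊤ := hs.measure_lt_top.ne
  have h1 := (ENNReal.tendsto_toReal hfin).comp (tendsto_volume_preimage_gridPoint b w hw hs hsm hfr)
  have hP : ∏ i, volume.real (ZSpan.fundamentalDomain (b i)) ≠ 0 := by
    refine Finset.prod_ne_zero_iff.mpr fun i _ => ?_
    exact (ENNReal.toReal_pos (ZSpan.measure_fundamentalDomain_ne_zero (b i))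
      (ZSpan.fundamentalDomain_isBounded (b i)).measure_lt_top.ne).ne'
  refine (h1.div_const _).congr' ?_
  filter_upwards [eventually_gt_atTop 0] with t ht
  rw [Function.comp_apply, volume_preimage_gridPoint b w hs ht, ENNReal.toReal_mul,
    ENNReal.toReal_natCast, ENNReal.toReal_prod]
  simp_rw [ENNReal.toReal_mul, ENNReal.toReal_ofReal (inv_nonneg.mpr (pow_nonneg
    (pow_nonneg ht.le _) _)), Finset.prod_mul_distrib]
  rw [mul_div_assoc, mul_div_assoc]
  simp_rw [Measure.real] at hP ⊢
  rw [div_self hP, mul_one, Finset.prod_inv_distrib, ← div_eq_mul_inv, ← Finset.prod_pow_eq_pow_sum]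
  congr 2
  exact funext fun i => by rw [← pow_mul, ← pow_mul, mul_comm]

end LatticeCount

/-! ### Measures on the mixed space seen through absolute values -/

section NormMeasure

open MeasureTheory Topology Module NumberField.mixedEmbedding NumberField.InfinitePlace
open scoped NNReal ENNReal Classical

variable {K : Type*} [Field K]

/-- Multiplication by an element `e` of absolute value one at every place carries `x` to `y` and
preserves both `s` and its complement. This lets volume formulas for norm-invariant sets be applied
to frontiers. -/
theorem mem_frontier_of_normAtPlace_eq {s : Set (mixedSpace K)}
    (hs : ∀ x y, (∀ v, normAtPlace v x = normAtPlace v y) → x ∈ s → y ∈ s) {x y : mixedSpace K}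
    (hxy : ∀ v, normAtPlace v x = normAtPlace v y) (hx : x ∈ frontier s) : y ∈ frontier s := by
  -- Where `x` vanishes so does `y`, and the value `1` keeps `e` of absolute value one there.
  let e : mixedSpace K := (fun v => if x.1 v = 0 then 1 else y.1 v / x.1 v,
    fun v => if x.2 v = 0 then 1 else y.2 v / x.2 v)
  have he : ∀ v, normAtPlace v e = 1 := by
    intro v
    rcases isReal_or_isComplex v with hv | hv
    · have := hxy v
      simp only [normAtPlace_apply_of_isReal hv] at this ⊢
      simp only [e]
      split_ifs with h
      · simp
      · rw [norm_div, ← this, div_self (norm_ne_zero_iff.mpr h)]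
    · have := hxy v
      simp only [normAtPlace_apply_of_isComplex hv] at this ⊢
      simp only [e]
      split_ifs with h
      · simp
      · rw [norm_div, ← this, div_self (norm_ne_zero_iff.mpr h)]
  have hex : e * x = y := by
    refine Prod.ext (funext fun v => ?_) (funext fun v => ?_)
    · have := hxy v.1
      simp only [normAtPlace_apply_of_isReal v.2] at this
      simp only [e, Prod.fst_mul, Pi.mul_apply]
      split_ifs with h
      · rw [h, norm_zero, eq_comm, norm_eq_zero] at this
        rw [h, mul_zero]; exact this.symm
      · rw [div_mul_cancel₀ _ h]
    · have := hxy v.1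
      simp only [normAtPlace_apply_of_isComplex v.2] at this
      simp only [e, Prod.snd_mul, Pi.mul_apply]
      split_ifs with h
      · rw [h, norm_zero, eq_comm, norm_eq_zero] at this
        rw [h, mul_zero]; exact this.symm
      · rw [div_mul_cancel₀ _ h]
  have hpre : ∀ z, e * z ∈ s ↔ z ∈ s := fun z =>
    ⟨hs _ _ fun v => by rw [map_mul, he, one_mul], hs _ _ fun v => by rw [map_mul, he, one_mul]⟩
  have hcont : Continuous fun z => e * z := continuous_const.mul continuous_id
  have hcl : ∀ {t : Set (mixedSpace K)}, (∀ z, z ∈ t → e * z ∈ t) → x ∈ closure t →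
      y ∈ closure t := by
    intro t ht hxt
    rw [← hex]
    exact map_mem_closure hcont hxt ht
  rw [frontier_eq_closure_inter_closure] at hx ⊢
  exact ⟨hcl (fun z => (hpre z).mpr) hx.1, hcl (fun z hz h => hz ((hpre z).mp h)) hx.2⟩
theorem setOf_normAtPlace_lt_eq_convexBodyLT (a : InfinitePlace K → ℝ≥0) :
    {x : mixedSpace K | ∀ v, normAtPlace v x < a v} = convexBodyLT K a := by
  ext x
  simp only [Set.mem_ofPred_eq, convexBodyLT, Set.mem_prod, Set.mem_pi, Set.mem_univ,
    forall_true_left, mem_ball_zero_iff, Subtype.forall]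
  constructor
  · intro h
    exact ⟨fun v hv => by simpa [normAtPlace_apply_of_isReal hv] using h v,
      fun v hv => by simpa [normAtPlace_apply_of_isComplex hv] using h v⟩
  · rintro ⟨h1, h2⟩ v
    rcases isReal_or_isComplex v with hv | hv
    · simpa [normAtPlace_apply_of_isReal hv] using h1 v hv
    · simpa [normAtPlace_apply_of_isComplex hv] using h2 v hv

variable [NumberField K]

theorem volume_setOf_normAtPlace_lt (a : InfinitePlace K → ℝ≥0) :
    volume {x : mixedSpace K | ∀ v, normAtPlace v x < a v} =
      convexBodyLTFactor K * ∏ v, (a v : ℝ≥0∞) ^ v.mult := by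
  rw [setOf_normAtPlace_lt_eq_convexBodyLT, convexBodyLT_volume]
  push_cast
  rfl

/-- A measurable map to the nonnegative orthant of `realSpace K` whose sublevel boxes have
measures proportional to the volumes of the boxes in `mixedSpace K` pushes the measure
forward to a multiple of the pushforward of the volume of `mixedSpace K`. -/
theorem map_eq_smul_map_normAtAllPlaces {X : Type*} [MeasurableSpace X] (μ : Measure X)
    {f : X → realSpace K} (hf : Measurable f) (hf0 : ∀ x v, 0 ≤ f x v) {c : ℝ≥0∞} (hc : c ≠ ⊤)
    (h : ∀ a : InfinitePlace K → ℝ≥0, μ {x | ∀ v, f x v < a v} =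
      c * (convexBodyLTFactor K * ∏ v, (a v : ℝ≥0∞) ^ v.mult)) :
    μ.map f = c • (volume : Measure (mixedSpace K)).map normAtAllPlaces := by
  have hN : Measurable (normAtAllPlaces : mixedSpace K → realSpace K) :=
    (continuous_normAtAllPlaces K).measurable
  have key (a : InfinitePlace K → ℝ) :
      (μ.map f) (Set.univ.pi fun v => Set.Iio (a v)) =
        c * (convexBodyLTFactor K * ∏ v, ((a v).toNNReal : ℝ≥0∞) ^ v.mult) ∧
      (volume.map normAtAllPlaces) (Set.univ.pi fun v => Set.Iio (a v)) =
        convexBodyLTFactor K * ∏ v, ((a v).toNNReal : ℝ≥0∞) ^ v.mult := by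
    have hm : MeasurableSet (Set.univ.pi fun v => Set.Iio (a v)) :=
      MeasurableSet.univ_pi fun v => measurableSet_Iio
    -- A negative bound gives an empty condition, and so does its truncation to zero.
    have hlt : ∀ r b : ℝ, 0 ≤ r → (r < b ↔ r < b.toNNReal) := fun r b hr => by
      rw [Real.coe_toNNReal', lt_max_iff]
      exact ⟨Or.inl, fun h => h.resolve_right hr.not_gt⟩
    rw [Measure.map_apply hf hm, Measure.map_apply hN hm, ← h, ← volume_setOf_normAtPlace_lt]
    constructor <;> congr 1 <;> ext x <;>
      simp only [Set.mem_preimage, Set.mem_pi, Set.mem_univ, forall_const, Set.mem_Iio,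
        Set.mem_ofPred_eq]
    · exact forall_congr' fun v => hlt _ _ (hf0 x v)
    · exact forall_congr' fun v => hlt _ _ (normAtPlace_nonneg v x)
  -- Products of lower half-lines form a π-system generating the Borel sets, and the cubes bounded
  -- above by `N` exhaust the space with finite measure.
  refine Measure.ext_of_generateFrom_of_iUnion
    (Set.pi Set.univ '' Set.pi Set.univ fun _ : InfinitePlace K => Set.range (Set.Iio (α := ℝ)))
    (fun N : ℕ => Set.univ.pi fun _ => Set.Iio (N : ℝ)) ?_ ?_ ?_ ?_ ?_ ?_
  · refine (generateFrom_eq_pi (fun _ => ?_) fun _ => ?_).symm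
    · rw [← borel_eq_generateFrom_Iio, BorelSpace.measurable_eq (α := ℝ)]
    · exact ⟨fun N : ℕ => Set.Iio (N : ℝ), fun N => ⟨_, rfl⟩,
        Set.eq_univ_of_forall fun x => Set.mem_iUnion.mpr (exists_nat_gt x)⟩
  · exact IsPiSystem.pi fun _ => isPiSystem_Iio
  · refine Set.eq_univ_of_forall fun x => Set.mem_iUnion.mpr ?_
    obtain ⟨N, hN⟩ := exists_nat_gt ‖x‖
    refine ⟨N, fun v _ => ((le_abs_self _).trans (norm_le_pi_norm x v)).trans_lt hN⟩
  · exact fun N => ⟨fun _ => Set.Iio (N : ℝ), fun _ _ => ⟨_, rfl⟩, rfl⟩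
  · intro N
    rw [(key fun _ => (N : ℝ)).1]
    exact ENNReal.mul_ne_top hc (ENNReal.mul_ne_top ENNReal.coe_ne_top
      (ENNReal.prod_ne_top fun v _ => ENNReal.pow_ne_top ENNReal.coe_ne_top))
  · rintro _ ⟨t, ht, rfl⟩
    choose a ha using fun v => ht v trivial
    obtain rfl : (fun v => Set.Iio (a v)) = t := funext ha
    rw [(key a).1, Measure.smul_apply, (key a).2, smul_eq_mul]

/-- A linear map scales volume by a constant, which can be read off from one box: the preimage of
the unit box is a box with sides `(v u)⁻¹`, and it has the same volume because `u` has norm `±1`. -/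
theorem volume_preimage_unit_smul (u : (𝓞 K)ˣ) (s : Set (mixedSpace K)) :
    volume ((fun x => u • x) ⁻¹' s) = volume s := by
  let L : mixedSpace K →ₗ[ℝ] mixedSpace K := LinearMap.mulLeft ℝ (mixedEmbedding K u)
  have hL : ∀ x, L x = u • x := fun x => rfl
  have hdet : LinearMap.det L ≠ 0 := by
    let L' : mixedSpace K →ₗ[ℝ] mixedSpace K :=
      LinearMap.mulLeft ℝ (mixedEmbedding K ((u⁻¹ : (𝓞 K)ˣ) : 𝓞 K))
    have : L' ∘ₗ L = LinearMap.id := LinearMap.ext fun x => inv_smul_smul u x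
    intro h
    have h2 := congrArg LinearMap.det this
    rw [LinearMap.det_comp, h, mul_zero, LinearMap.det_id] at h2
    exact zero_ne_one h2
  have hpre (s : Set (mixedSpace K)) := Measure.addHaar_preimage_linearMap volume hdet s
  have hbox : volume (L ⁻¹' {x | ∀ v, normAtPlace v x < (1 : ℝ≥0)}) =
      volume {x : mixedSpace K | ∀ v, normAtPlace v x < (1 : ℝ≥0)} := by
    have hu : ∀ v : InfinitePlace K, 0 < v (u : K) := fun v => by
      rw [InfinitePlace.pos_iff]; simp
    let a : InfinitePlace K → ℝ≥0 := fun v => ⟨(v (u : K))⁻¹, by positivity⟩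
    have : L ⁻¹' {x | ∀ v, normAtPlace v x < (1 : ℝ≥0)} = {x | ∀ v, normAtPlace v x < a v} := by
      ext x
      refine forall_congr' fun v => ?_
      rw [hL, unitSMul_smul, map_mul, normAtPlace_apply]
      change _ < (1 : ℝ) ↔ _ < (v (u : K))⁻¹
      rw [← one_div, lt_div_iff₀' (hu v)]
    rw [this, volume_setOf_normAtPlace_lt, volume_setOf_normAtPlace_lt]
    congr 1
    simp_rw [← ENNReal.coe_pow, ← ENNReal.ofNNReal_finsetProd]
    congr 1
    rw [← NNReal.coe_inj]
    push_cast
    have h1 := prod_eq_abs_norm (u : K)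
    rw [Units.norm, Rat.cast_one] at h1
    change ∏ v : InfinitePlace K, (v (u : K))⁻¹ ^ v.mult = ∏ v : InfinitePlace K, 1 ^ v.mult
    simp_rw [inv_pow, Finset.prod_inv_distrib, h1, one_pow, Finset.prod_const_one, inv_one]
  rw [hpre] at hbox
  have h1 : ENNReal.ofReal |(LinearMap.det L)⁻¹| = 1 := by
    rw [volume_setOf_normAtPlace_lt] at hbox
    refine (ENNReal.mul_left_inj ?_ ?_).mp (hbox.trans (one_mul _).symm)
    · exact mul_ne_zero (ENNReal.coe_ne_zero.mpr (convexBodyLTFactor_ne_zero K)) (by simp)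
    · simp [ENNReal.mul_eq_top]
  have := hpre s
  rwa [h1, one_mul] at this

end NormMeasure

theorem frontier_iUnion_subset_of_finite {X ι : Type*} [TopologicalSpace X] [Finite ι]
    (s : ι → Set X) : frontier (⋃ i, s i) ⊆ ⋃ i, frontier (s i) := by
  rintro x ⟨hx, hx'⟩
  rw [closure_iUnion_of_finite, Set.mem_iUnion] at hx
  obtain ⟨i, hi⟩ := hx
  exact Set.mem_iUnion.mpr
    ⟨i, hi, fun h => hx' (interior_mono (Set.subset_iUnion s i) h)⟩

/-! ### Dilating the logarithmic fundamental domain -/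

section ScaledCone

open MeasureTheory Topology Module NumberField.mixedEmbedding NumberField.InfinitePlace
open NumberField.mixedEmbedding.fundamentalCone NumberField.Units
  NumberField.Units.dirichletUnitTheorem
open scoped NNReal ENNReal Classical

variable (K : Type*) [Field K] [NumberField K]

/-- The real basis of the logarithmic space given by a fundamental system of units. -/
abbrev unitBasis : Basis (Fin (rank K)) ℝ (logSpace K) :=
  (basisUnitLattice K).ofZLatticeBasis ℝ (unitLattice K)

/-- The elements of norm at most `1` whose logarithm lies in the dilate by `k` of the fundamental
domain of the unit lattice. -/
def scaledNormLeOne (k : ℕ) : Set (mixedSpace K) :=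
  {x | mixedEmbedding.norm x ≠ 0 ∧ mixedEmbedding.norm x ≤ 1 ∧
    ∀ i, (unitBasis K).repr (logMap x) i ∈ Set.Ico (0 : ℝ) k}

/-- A product of powers of fundamental units. -/
def unitOfExponents (j : Fin (rank K) → ℕ) : (𝓞 K)ˣ := ∏ i, fundSystem K i ^ j i

variable {K}

theorem mem_normLeOne_iff (x : mixedSpace K) :
    x ∈ normLeOne K ↔ mixedEmbedding.norm x ≠ 0 ∧ mixedEmbedding.norm x ≤ 1 ∧
      ∀ i, (unitBasis K).repr (logMap x) i ∈ Set.Ico (0 : ℝ) 1 := by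
  rw [mem_normLeOne, fundamentalCone, Set.mem_sdiff, Set.mem_preimage, ZSpan.mem_fundamentalDomain]
  change (_ ∧ ¬ _ = _) ∧ _ ↔ _
  tauto

theorem repr_logMap_unitOfExponents_inv_smul (j : Fin (rank K) → ℕ) {x : mixedSpace K}
    (hx : mixedEmbedding.norm x ≠ 0) (i : Fin (rank K)) :
    (unitBasis K).repr (logMap ((unitOfExponents K j)⁻¹ • x)) i =
      (unitBasis K).repr (logMap x) i - j i := by
  have h : logEmbedding K (Additive.ofMul (unitOfExponents K j)⁻¹) =
      - ∑ l, (j l : ℝ) • unitBasis K l := by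
    rw [unitOfExponents, ofMul_inv, map_neg, ofMul_prod, map_sum]
    refine congrArg _ (Finset.sum_congr rfl fun l _ => ?_)
    rw [ofMul_pow, map_nsmul, logEmbedding_fundSystem, Basis.ofZLatticeBasis_apply,
      Nat.cast_smul_eq_nsmul]
  rw [logMap_unit_smul _ hx, h, map_add, map_neg, Finsupp.add_apply, Finsupp.neg_apply,
    Basis.repr_sum_self]
  ring

theorem unitOfExponents_inv_smul_mem_normLeOne_iff (j : Fin (rank K) → ℕ) (x : mixedSpace K) :
    (unitOfExponents K j)⁻¹ • x ∈ normLeOne K ↔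
      mixedEmbedding.norm x ≠ 0 ∧ mixedEmbedding.norm x ≤ 1 ∧
        ∀ i, ⌊(unitBasis K).repr (logMap x) i⌋ = (j i : ℤ) := by
  rw [mem_normLeOne_iff, norm_unit_smul]
  refine and_congr_right fun hx => and_congr_right fun _ => forall_congr' fun i => ?_
  rw [repr_logMap_unitOfExponents_inv_smul j hx, Int.floor_eq_iff, Set.mem_Ico, sub_nonneg,
    sub_lt_iff_lt_add']
  push_cast
  rfl

variable (K) in
-- The integer parts of the logarithmic coordinates, each in `[0, k)`, are the exponents of the unit
-- that brings a point back to the undilated domain.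
theorem scaledNormLeOne_eq_iUnion (k : ℕ) :
    scaledNormLeOne K k = ⋃ j : Fin (rank K) → Fin k,
      (fun x => (unitOfExponents K fun i => j i)⁻¹ • x) ⁻¹' normLeOne K := by
  ext x
  simp only [Set.mem_iUnion, Set.mem_preimage, unitOfExponents_inv_smul_mem_normLeOne_iff]
  constructor
  · rintro ⟨h1, h2, h3⟩
    have hf : ∀ i, ∃ l : Fin k, ⌊(unitBasis K).repr (logMap x) i⌋ = ((l : ℕ) : ℤ) := fun i => by
      obtain ⟨l, hl⟩ := Int.eq_ofNat_of_zero_le (Int.floor_nonneg.mpr (h3 i).1)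
      refine ⟨⟨l, ?_⟩, hl⟩
      have hlt : ⌊(unitBasis K).repr (logMap x) i⌋ < (k : ℤ) :=
        Int.floor_lt.mpr (by exact_mod_cast (h3 i).2)
      rw [hl] at hlt
      exact_mod_cast hlt
    choose j hj using hf
    exact ⟨j, h1, h2, hj⟩
  · rintro ⟨j, h1, h2, h3⟩
    refine ⟨h1, h2, fun i => ⟨?_, ?_⟩⟩
    · rw [← Int.floor_nonneg, h3 i]
      exact Int.natCast_nonneg _
    · have : ⌊(unitBasis K).repr (logMap x) i⌋ < (k : ℤ) := by
        rw [h3 i]; exact_mod_cast (j i).2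
      exact_mod_cast Int.floor_lt.mp this

variable (K)

theorem measurable_unit_smul (u : (𝓞 K)ˣ) : Measurable fun x : mixedSpace K => u • x :=
  (continuous_const.mul continuous_id : Continuous fun x => mixedEmbedding K u * x).measurable

theorem measurableSet_scaledNormLeOne (k : ℕ) : MeasurableSet (scaledNormLeOne K k) := by
  rw [scaledNormLeOne_eq_iUnion]
  exact MeasurableSet.iUnion fun j => measurable_unit_smul K _ (measurableSet_normLeOne K)

theorem volume_scaledNormLeOne (k : ℕ) :
    volume (scaledNormLeOne K k) = k ^ rank K * volume (normLeOne K) := by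
  rw [scaledNormLeOne_eq_iUnion, measure_iUnion]
  · simp_rw [volume_preimage_unit_smul, tsum_fintype, Finset.sum_const, Finset.card_univ,
      Fintype.card_pi, Fintype.card_fin, Finset.prod_const, Finset.card_univ, Fintype.card_fin,
      nsmul_eq_mul]
    push_cast
    rfl
  · intro j j' hne
    rw [Function.onFun, Set.disjoint_left]
    intro x hx hx'
    rw [Set.mem_preimage, unitOfExponents_inv_smul_mem_normLeOne_iff] at hx hx'
    refine hne (funext fun i => Fin.ext ?_)
    exact_mod_cast (hx.2.2 i).symm.trans (hx'.2.2 i)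
  · exact fun j => measurable_unit_smul K _ (measurableSet_normLeOne K)

theorem volume_frontier_scaledNormLeOne (k : ℕ) :
    volume (frontier (scaledNormLeOne K k)) = 0 := by
  have hsub : frontier (scaledNormLeOne K k) ⊆ ⋃ j : Fin (rank K) → Fin k,
      (fun x => (unitOfExponents K fun i => j i)⁻¹ • x) ⁻¹' frontier (normLeOne K) := by
    rw [scaledNormLeOne_eq_iUnion]
    refine (frontier_iUnion_subset_of_finite _).trans (Set.iUnion_mono fun j => ?_)
    exact (continuous_const.mul continuous_id :
      Continuous fun x => mixedEmbedding K _ * x).frontier_preimage_subset _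
  refine measure_mono_null hsub (measure_iUnion_null fun j => ?_)
  rw [volume_preimage_unit_smul, volume_frontier_normLeOne]

theorem scaledNormLeOne_normInvariant (k : ℕ) {x y : mixedSpace K}
    (hxy : ∀ v, normAtPlace v x = normAtPlace v y) (hx : x ∈ scaledNormLeOne K k) :
    y ∈ scaledNormLeOne K k := by
  rw [scaledNormLeOne, Set.mem_ofPred_eq] at hx ⊢
  rwa [← norm_eq_of_normAtPlace_eq hxy, ← logMap_eq_of_normAtPlace_eq hxy]

end ScaledCone

/-! ### The region cut out by weighted norms and its volume -/

section WeightedNorm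

open MeasureTheory Topology Module NumberField.mixedEmbedding NumberField.InfinitePlace
open NumberField.mixedEmbedding.fundamentalCone NumberField.Units
open scoped NNReal ENNReal Classical

variable {n : ℕ} (w : Fin (n + 1) → ℕ+) {K : Type*} [Field K]

/-- The weighted maximum norms of a tuple of elements of the mixed space at all infinite places. -/
def weightedNorm (y : Fin (n + 1) → mixedSpace K) : realSpace K :=
  fun v => ⨆ i, normAtPlace v (y i) ^ ((w i : ℕ) : ℝ)⁻¹

theorem weightedNorm_nonneg (y : Fin (n + 1) → mixedSpace K) (v : InfinitePlace K) :
    0 ≤ weightedNorm w y v :=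
  Real.iSup_nonneg fun _ => Real.rpow_nonneg (normAtPlace_nonneg _ _) _

theorem weightedNorm_apply_eq_sup' (y : Fin (n + 1) → mixedSpace K) (v : InfinitePlace K) :
    weightedNorm w y v = Finset.univ.sup' Finset.univ_nonempty
      fun i => normAtPlace v (y i) ^ ((w i : ℕ) : ℝ)⁻¹ :=
  (Finset.sup'_univ_eq_ciSup _).symm

theorem rpow_le_weightedNorm (y : Fin (n + 1) → mixedSpace K) (v : InfinitePlace K)
    (i : Fin (n + 1)) : normAtPlace v (y i) ^ ((w i : ℕ) : ℝ)⁻¹ ≤ weightedNorm w y v := by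
  rw [weightedNorm_apply_eq_sup']
  exact Finset.le_sup' (fun i => normAtPlace v (y i) ^ ((w i : ℕ) : ℝ)⁻¹) (Finset.mem_univ i)

theorem weightedNorm_smul {t : ℝ} (ht : 0 ≤ t) (y : Fin (n + 1) → mixedSpace K) :
    weightedNorm w (fun i => t ^ (w i : ℕ) • y i) = t • weightedNorm w y := by
  ext v
  rw [Pi.smul_apply, smul_eq_mul, weightedNorm, weightedNorm, Real.mul_iSup_of_nonneg ht]
  refine congrArg _ (funext fun i => ?_)
  rw [normAtPlace_smul, Real.mul_rpow (abs_nonneg _) (normAtPlace_nonneg _ _),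
    abs_of_nonneg (by positivity), Real.pow_rpow_inv_natCast ht (w i).ne_zero]

theorem weightedNorm_mul_apply (c : K) (y : Fin (n + 1) → mixedSpace K) (v : InfinitePlace K) :
    weightedNorm w (fun i => mixedEmbedding K c ^ (w i : ℕ) * y i) v =
      v c * weightedNorm w y v := by
  rw [weightedNorm, weightedNorm, Real.mul_iSup_of_nonneg (by positivity)]
  refine congrArg _ (funext fun i => ?_)
  rw [map_mul, map_pow, normAtPlace_apply, Real.mul_rpow (by positivity) (normAtPlace_nonneg _ _),
    Real.pow_rpow_inv_natCast (by positivity) (w i).ne_zero]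

theorem continuous_weightedNorm :
    Continuous (weightedNorm w : (Fin (n + 1) → mixedSpace K) → realSpace K) := by
  refine continuous_pi fun v => ?_
  simp_rw [weightedNorm_apply_eq_sup']
  refine Continuous.finset_sup'_apply _ fun i _ => ?_
  exact Continuous.rpow_const ((continuous_normAtPlace v).comp (continuous_apply i))
    fun _ => Or.inr (by positivity)

variable [NumberField K]

/-- The tuples whose weighted norms are those of an element of the fundamental cone of norm at
most `1`. -/
def weightedNormLeOne (K : Type*) [Field K] [NumberField K] : Set (Fin (n + 1) → mixedSpace K) :=
  {y | mixedSpaceOfRealSpace (weightedNorm w y) ∈ normLeOne K}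

theorem norm_mixedSpaceOfRealSpace {r : realSpace K} (hr : ∀ v, 0 ≤ r v) :
    mixedEmbedding.norm (mixedSpaceOfRealSpace r) = ∏ v, r v ^ v.mult := by
  rw [mixedEmbedding.norm_apply]
  exact Finset.prod_congr rfl fun v _ => by rw [normAtPlace_mixedSpaceOfRealSpace (hr v)]

theorem measurableSet_weightedNormLeOne : MeasurableSet (weightedNormLeOne w K) :=
  measurableSet_preimage ((mixedSpaceOfRealSpace.continuous.comp
    (continuous_weightedNorm w)).measurable) (measurableSet_normLeOne K)

theorem isBounded_weightedNormLeOne : Bornology.IsBounded (weightedNormLeOne w K) := by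
  obtain ⟨C, hC⟩ := (isBounded_normLeOne K).exists_norm_le
  refine isBounded_iff_forall_norm_le.mpr ⟨∑ i, (|C|) ^ (w i : ℕ), fun y hy => ?_⟩
  have hnn : ∀ i ∈ Finset.univ, 0 ≤ (|C|) ^ (w i : ℕ) := fun i _ => by positivity
  rw [pi_norm_le_iff_of_nonneg (Finset.sum_nonneg hnn)]
  intro i
  rw [norm_eq_sup'_normAtPlace]
  refine Finset.sup'_le _ _ fun v _ => ?_
  refine le_trans ?_ (Finset.single_le_sum hnn (Finset.mem_univ i))
  have h1 := hC _ hy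
  rw [norm_eq_sup'_normAtPlace] at h1
  have h2 := (Finset.le_sup' (fun v => normAtPlace v (mixedSpaceOfRealSpace (weightedNorm w y)))
    (Finset.mem_univ v)).trans h1
  rw [normAtPlace_mixedSpaceOfRealSpace (weightedNorm_nonneg w y v)] at h2
  have h3 := ((rpow_le_weightedNorm w y v i).trans h2).trans (le_abs_self C)
  have h4 := pow_le_pow_left₀ (Real.rpow_nonneg (normAtPlace_nonneg v (y i)) _) h3 (w i : ℕ)
  rwa [Real.rpow_inv_natCast_pow (normAtPlace_nonneg _ _) (w i).ne_zero] at h4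

theorem weightSum_pos : 0 < weightSum w :=
  Finset.sum_pos (fun i _ => (w i).pos) Finset.univ_nonempty

/-- The power `|w|` multiplies `logMap` by `|w|` and leaves the condition of norm at most one
unchanged, so coordinates in `[0, 1)` become coordinates in `[0, |w|)`. -/
theorem mem_weightedNormLeOne_iff (y : Fin (n + 1) → mixedSpace K) :
    y ∈ weightedNormLeOne w K ↔
      mixedSpaceOfRealSpace (weightedNorm w y ^ weightSum w) ∈
        scaledNormLeOne K (weightSum w) := by
  have hk : weightSum w ≠ 0 := (weightSum_pos w).ne'
  have h0 := weightedNorm_nonneg w y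
  have hnn : ∀ v, 0 ≤ (weightedNorm w y ^ weightSum w) v := fun v => pow_nonneg (h0 v) _
  have hnorm : mixedEmbedding.norm (mixedSpaceOfRealSpace (weightedNorm w y ^ weightSum w)) =
      mixedEmbedding.norm (mixedSpaceOfRealSpace (weightedNorm w y)) ^ weightSum w := by
    rw [norm_mixedSpaceOfRealSpace hnn, norm_mixedSpaceOfRealSpace h0, ← Finset.prod_pow]
    exact Finset.prod_congr rfl fun v _ => by rw [Pi.pow_apply, ← pow_mul, ← pow_mul, mul_comm]
  have hlog : logMap (mixedSpaceOfRealSpace (weightedNorm w y ^ weightSum w)) =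
      (weightSum w : ℝ) • logMap (mixedSpaceOfRealSpace (weightedNorm w y)) := by
    ext v
    rw [Pi.smul_apply, logMap_apply, logMap_apply, hnorm, Real.log_pow,
      normAtPlace_mixedSpaceOfRealSpace (hnn v), normAtPlace_mixedSpaceOfRealSpace (h0 v),
      Pi.pow_apply, Real.log_pow, smul_eq_mul]
    ring
  rw [weightedNormLeOne, Set.mem_ofPred_eq, mem_normLeOne_iff, scaledNormLeOne, Set.mem_ofPred_eq,
    hnorm, hlog, pow_ne_zero_iff hk, pow_le_one_iff_of_nonneg (mixedEmbedding.norm_nonneg _) hk,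
    map_smul]
  refine and_congr_right fun _ => and_congr_right fun _ => forall_congr' fun i => ?_
  have hk' : (0 : ℝ) < weightSum w := by exact_mod_cast weightSum_pos w
  rw [Finsupp.smul_apply, smul_eq_mul, Set.mem_Ico, Set.mem_Ico, mul_nonneg_iff_of_pos_left hk',
    mul_lt_iff_lt_one_right hk']

/-- The bound on a maximum decouples into the bounds `a v ^ (w i / |w|)` on the separate
coordinates. These exponents sum to one over `i`, so the product of the box volumes depends on `a`
as a single box does. -/
theorem volume_setOf_weightedNorm_pow_lt (a : InfinitePlace K → ℝ≥0) :
    volume {y : Fin (n + 1) → mixedSpace K | ∀ v, (weightedNorm w y ^ weightSum w) v < a v} =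
      (convexBodyLTFactor K : ℝ≥0∞) ^ n *
        (convexBodyLTFactor K * ∏ v, (a v : ℝ≥0∞) ^ v.mult) := by
  have hk' : (0 : ℝ) < weightSum w := by exact_mod_cast weightSum_pos w
  have hset : {y : Fin (n + 1) → mixedSpace K | ∀ v, (weightedNorm w y ^ weightSum w) v < a v} =
      Set.univ.pi fun i => {x : mixedSpace K | ∀ v, normAtPlace v x <
        (a v ^ ((w i : ℕ) / (weightSum w : ℝ)) : ℝ≥0)} := by
    ext y
    simp only [Set.mem_ofPred_eq, Set.mem_pi, Set.mem_univ, forall_const]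
    rw [forall_comm]
    refine forall_congr' fun v => ?_
    rw [Pi.pow_apply, ← Real.rpow_natCast, ← Real.lt_rpow_inv_iff_of_pos
      (weightedNorm_nonneg w y v) (a v).coe_nonneg hk', weightedNorm_apply_eq_sup', Finset.sup'_lt_iff]
    refine ⟨fun h i => ?_, fun h i _ => ?_⟩
    · have := h i (Finset.mem_univ i)
      rw [Real.rpow_inv_lt_iff_of_pos (normAtPlace_nonneg _ _) (by positivity)
        (by exact_mod_cast (w i).pos), ← Real.rpow_mul (a v).coe_nonneg] at this
      rw [NNReal.coe_rpow, div_eq_inv_mul]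
      exact this
    · rw [Real.rpow_inv_lt_iff_of_pos (normAtPlace_nonneg _ _) (by positivity)
        (by exact_mod_cast (w i).pos), ← Real.rpow_mul (a v).coe_nonneg]
      have := h i
      rw [NNReal.coe_rpow, div_eq_inv_mul] at this
      exact this
  rw [hset, volume_pi_pi]
  simp_rw [volume_setOf_normAtPlace_lt]
  rw [Finset.prod_mul_distrib, Finset.prod_const, Finset.card_univ, Fintype.card_fin, pow_succ,
    mul_assoc, Finset.prod_comm]
  congr 2
  refine Finset.prod_congr rfl fun v _ => ?_
  rw [Finset.prod_pow]
  congr 1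
  rw [← ENNReal.ofNNReal_finsetProd]
  congr 1
  rw [← NNReal.coe_inj]
  push_cast
  rw [← Real.rpow_sum_of_nonneg (a v).coe_nonneg fun i _ => by positivity, ← Finset.sum_div]
  rw [show ∑ i, ((w i : ℕ) : ℝ) = (weightSum w : ℝ) by rw [weightSum]; push_cast; rfl,
    div_self hk'.ne', Real.rpow_one]

/-- The volume of the preimage of a norm-invariant set of the mixed space under the map
`weightedNorm w ^ weightSum w`. -/
theorem volume_preimage_weightedNorm_pow {s : Set (mixedSpace K)} (hs : MeasurableSet s)
    (hinv : ∀ x y, (∀ v, normAtPlace v x = normAtPlace v y) → x ∈ s → y ∈ s) :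
    volume {y : Fin (n + 1) → mixedSpace K |
        mixedSpaceOfRealSpace (weightedNorm w y ^ weightSum w) ∈ s} =
      (convexBodyLTFactor K : ℝ≥0∞) ^ n * volume s := by
  have hmeas : Measurable fun y : Fin (n + 1) → mixedSpace K => weightedNorm w y ^ weightSum w :=
    ((continuous_weightedNorm w).pow _).measurable
  have hmap := map_eq_smul_map_normAtAllPlaces volume hmeas
    (fun y v => pow_nonneg (weightedNorm_nonneg w y v) _)
    (c := (convexBodyLTFactor K : ℝ≥0∞) ^ n) (ENNReal.pow_ne_top ENNReal.coe_ne_top)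
    (volume_setOf_weightedNorm_pow_lt w)
  have hms : MeasurableSet (mixedSpaceOfRealSpace ⁻¹' s : Set (realSpace K)) :=
    mixedSpaceOfRealSpace.continuous.measurable hs
  have h := congrArg (fun μ => μ (mixedSpaceOfRealSpace ⁻¹' s)) hmap
  simp only [Measure.smul_apply, smul_eq_mul] at h
  rw [Measure.map_apply hmeas hms,
    Measure.map_apply (continuous_normAtAllPlaces K).measurable hms] at h
  have hss : (normAtAllPlaces ⁻¹' (mixedSpaceOfRealSpace ⁻¹' s) : Set (mixedSpace K)) = s := by
    ext x
    have : ∀ v, normAtPlace v (mixedSpaceOfRealSpace (normAtAllPlaces x)) = normAtPlace v x :=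
      fun v => normAtPlace_mixedSpaceOfRealSpace (normAtPlace_nonneg _ _)
    exact ⟨hinv _ _ this, hinv _ _ fun v => (this v).symm⟩
  rw [hss] at h
  exact h

theorem volume_weightedNormLeOne :
    volume (weightedNormLeOne w K) = (convexBodyLTFactor K : ℝ≥0∞) ^ n *
      (weightSum w ^ rank K * volume (normLeOne K)) := by
  rw [← volume_scaledNormLeOne, ← volume_preimage_weightedNorm_pow w
    (measurableSet_scaledNormLeOne K _) fun _ _ => scaledNormLeOne_normInvariant K _]
  congr 1
  ext y
  exact mem_weightedNormLeOne_iff w y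

theorem volumeReal_weightedNormLeOne :
    volume.real (weightedNormLeOne w K) =
      (2 ^ nrRealPlaces K * Real.pi ^ nrComplexPlaces K) ^ (n + 1) *
        (weightSum w ^ rank K * regulator K) := by
  rw [Measure.real, volume_weightedNormLeOne, volume_normLeOne]
  simp only [ENNReal.toReal_mul, ENNReal.toReal_pow, ENNReal.toReal_natCast, ENNReal.coe_toReal,
    NNReal.coe_mul, NNReal.coe_pow, ENNReal.toReal_ofNat, NNReal.coe_ofNat, NNReal.coe_real_pi,
    ENNReal.toReal_ofReal (regulator_pos K).le]
  ring

/-- By continuity the frontier lies in the preimage of the frontier of `scaledNormLeOne`, which is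
again norm-invariant, so the volume formula for preimages gives zero. -/
theorem volume_frontier_weightedNormLeOne : volume (frontier (weightedNormLeOne w K)) = 0 := by
  have hcont : Continuous fun y : Fin (n + 1) → mixedSpace K =>
      mixedSpaceOfRealSpace (weightedNorm w y ^ weightSum w) :=
    mixedSpaceOfRealSpace.continuous.comp ((continuous_weightedNorm w).pow _)
  have heq : weightedNormLeOne w K = (fun y : Fin (n + 1) → mixedSpace K =>
      mixedSpaceOfRealSpace (weightedNorm w y ^ weightSum w)) ⁻¹'
        scaledNormLeOne K (weightSum w) := by
    ext y
    exact mem_weightedNormLeOne_iff w y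
  rw [heq]
  refine measure_mono_null (hcont.frontier_preimage_subset _) ?_
  refine (volume_preimage_weightedNorm_pow w measurableSet_frontier ?_).trans ?_
  · exact fun x y hxy => mem_frontier_of_normAtPlace_eq
      (fun _ _ => scaledNormLeOne_normInvariant K _) hxy
  · rw [volume_frontier_scaledNormLeOne, mul_zero]

end WeightedNorm

/-! ### Counting vectors with coordinates in powers of an ideal -/

section IdealCount

open MeasureTheory Topology Module NumberField.mixedEmbedding NumberField.InfinitePlace
open NumberField.mixedEmbedding.fundamentalCone NumberField.Units
open scoped NNReal ENNReal Classical

variable {n : ℕ} (w : Fin (n + 1) → ℕ+) {K : Type*} [Field K] [NumberField K]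

/-- The image of a tuple in the product of copies of the mixed space. -/
def tupleEmbedding (x : Fin (n + 1) → K) : Fin (n + 1) → mixedSpace K :=
  fun i => mixedEmbedding K (x i)

theorem tupleEmbedding_injective :
    Function.Injective (tupleEmbedding : (Fin (n + 1) → K) → Fin (n + 1) → mixedSpace K) :=
  fun _ _ h => funext fun i => mixedEmbedding_injective K (congrFun h i)

theorem archSize_eq_norm (x : Fin (n + 1) → K) :
    archSize w x =
      mixedEmbedding.norm (mixedSpaceOfRealSpace (weightedNorm w (tupleEmbedding x))) := by
  rw [norm_mixedSpaceOfRealSpace (weightedNorm_nonneg w _), archSize]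
  refine Finset.prod_congr rfl fun v _ => ?_
  rw [weightedNorm_apply_eq_sup', ← Finset.sup'_univ_eq_ciSup]
  have hnn : ∀ i, 0 ≤ normAtPlace v (tupleEmbedding x i) ^ ((w i : ℕ) : ℝ)⁻¹ := fun i =>
    Real.rpow_nonneg (normAtPlace_nonneg _ _) _
  have hterm : ∀ i, (v (x i) ^ v.mult) ^ (1 / ((w i : ℕ) : ℝ)) =
      (normAtPlace v (tupleEmbedding x i) ^ ((w i : ℕ) : ℝ)⁻¹) ^ v.mult := fun i => by
    rw [tupleEmbedding, normAtPlace_apply, one_div, ← Real.rpow_natCast, ← Real.rpow_natCast,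
      ← Real.rpow_mul (by positivity), ← Real.rpow_mul (by positivity), mul_comm]
  simp_rw [hterm]
  refine le_antisymm (Finset.sup'_le _ _ fun i hi => ?_) ?_
  · exact pow_le_pow_left₀ (hnn i) (Finset.le_sup'
      (fun i => normAtPlace v (tupleEmbedding x i) ^ ((w i : ℕ) : ℝ)⁻¹) hi) _
  · obtain ⟨i, hi, h⟩ := Finset.exists_mem_eq_sup' Finset.univ_nonempty
      fun i => normAtPlace v (tupleEmbedding x i) ^ ((w i : ℕ) : ℝ)⁻¹
    rw [h]
    exact Finset.le_sup'
      (fun i => (normAtPlace v (tupleEmbedding x i) ^ ((w i : ℕ) : ℝ)⁻¹) ^ v.mult) hi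

/-- The tuples with `x i ∈ a ^ w i` whose Archimedean size is at most `X * N(a)` and whose weighted
norms are those of an element of the fundamental cone. -/
def coneTuples (a : (FractionalIdeal (𝓞 K)⁰ K)ˣ) (X : ℝ) : Set (Fin (n + 1) → K) :=
  {x | (∀ i, x i ∈ (a : FractionalIdeal (𝓞 K)⁰ K) ^ (w i : ℕ)) ∧
    mixedSpaceOfRealSpace (weightedNorm w (tupleEmbedding x)) ∈ fundamentalCone K ∧
    archSize w x ≤ X * (FractionalIdeal.absNorm (a : FractionalIdeal (𝓞 K)⁰ K) : ℚ)}

theorem inv_smul_mem_weightedNormLeOne_iff {t : ℝ} (ht : 0 < t) (y : Fin (n + 1) → mixedSpace K) :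
    (fun i => (t ^ (w i : ℕ))⁻¹ • y i) ∈ weightedNormLeOne w K ↔
      mixedSpaceOfRealSpace (weightedNorm w y) ∈ fundamentalCone K ∧
        mixedEmbedding.norm (mixedSpaceOfRealSpace (weightedNorm w y)) ≤
          t ^ finrank ℝ (mixedSpace K) := by
  simp_rw [← inv_pow]
  rw [weightedNormLeOne, Set.mem_ofPred_eq, weightedNorm_smul w (inv_nonneg.mpr ht.le), map_smul,
    mem_normLeOne, smul_mem_iff_mem (inv_ne_zero ht.ne'), mixedEmbedding.norm_smul,
    abs_of_pos (inv_pos.mpr ht), mixedEmbedding.finrank, inv_pow,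
    inv_mul_le_iff₀ (by positivity), mul_one]

theorem absNorm_pos (a : (FractionalIdeal (𝓞 K)⁰ K)ˣ) :
    (0 : ℝ) < (FractionalIdeal.absNorm (a : FractionalIdeal (𝓞 K)⁰ K) : ℚ) := by
  have h := FractionalIdeal.absNorm_nonneg (a : FractionalIdeal (𝓞 K)⁰ K)
  have h' : FractionalIdeal.absNorm (a : FractionalIdeal (𝓞 K)⁰ K) ≠ 0 := fun h0 =>
    a.ne_zero (FractionalIdeal.absNorm_eq_zero_iff.mp h0)
  exact_mod_cast lt_of_le_of_ne h h'.symm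

/-- Bases of the images of the powers `a ^ w i` in the mixed space. -/
abbrev idealPowBasis (a : (FractionalIdeal (𝓞 K)⁰ K)ˣ) (i : Fin (n + 1)) :=
  fractionalIdealLatticeBasis K (a ^ (w i : ℕ))

/-- The parameter `t` turns the size bound into a weighted dilation. The dilation-invariant set `Z`
allows one count to serve both for all vectors and for those on a coordinate hyperplane. -/
theorem image_tupleEmbedding_coneTuples (a : (FractionalIdeal (𝓞 K)⁰ K)ˣ)
    {Z : Set (Fin (n + 1) → mixedSpace K)}
    (hZ : ∀ t : ℝ, 0 < t → ∀ y, (fun i => (t ^ (w i : ℕ))⁻¹ • y i) ∈ Z ↔ y ∈ Z)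
    {X t : ℝ} (ht : 0 < t)
    (htX : t ^ finrank ℝ (mixedSpace K) =
      X * (FractionalIdeal.absNorm (a : FractionalIdeal (𝓞 K)⁰ K) : ℚ)) :
    tupleEmbedding '' {x | x ∈ coneTuples w a X ∧ tupleEmbedding x ∈ Z} =
      gridSet (idealPowBasis w a) (fun i => (w i : ℕ)) (weightedNormLeOne w K ∩ Z) t := by
  ext y
  rw [gridSet, Set.mem_ofPred_eq, Set.mem_inter_iff, hZ t ht,
    inv_smul_mem_weightedNormLeOne_iff w ht, htX]
  simp_rw [mem_span_fractionalIdealLatticeBasis]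
  constructor
  · rintro ⟨x, ⟨⟨h1, h2, h3⟩, h4⟩, rfl⟩
    refine ⟨fun i => ⟨x i, ?_, rfl⟩, ⟨h2, ?_⟩, h4⟩
    · rw [Units.val_pow_eq_pow_val]
      exact h1 i
    · rwa [← archSize_eq_norm]
  · rintro ⟨h1, ⟨h2, h3⟩, h4⟩
    choose x hx hxy using h1
    obtain rfl : tupleEmbedding x = y := funext hxy
    refine ⟨x, ⟨⟨fun i => ?_, h2, ?_⟩, h4⟩, rfl⟩
    · have := hx i
      rw [Units.val_pow_eq_pow_val] at this
      exact this
    · rwa [archSize_eq_norm]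

theorem exists_pow_finrank_eq {Y : ℝ} (hY : 0 < Y) :
    ∃ t : ℝ, 0 < t ∧ t ^ finrank ℝ (mixedSpace K) = Y :=
  ⟨Y ^ ((finrank ℝ (mixedSpace K) : ℝ)⁻¹), Real.rpow_pos_of_pos hY _,
    Real.rpow_inv_natCast_pow hY.le finrank_pos.ne'⟩

theorem finite_coneTuples (a : (FractionalIdeal (𝓞 K)⁰ K)ˣ) (X : ℝ) :
    (coneTuples w a X).Finite := by
  -- Enlarging `X` only enlarges the set, and positivity is needed to extract the root `t`.
  have hX : (0 : ℝ) < max X 1 := by positivity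
  obtain ⟨t, ht, htX⟩ := exists_pow_finrank_eq (K := K) (mul_pos hX (absNorm_pos a))
  have himg := image_tupleEmbedding_coneTuples w a (Z := Set.univ) (by simp) ht htX
  have hfin : (coneTuples w a (max X 1)).Finite := by
    refine Set.Finite.of_finite_image (f := tupleEmbedding) ?_ tupleEmbedding_injective.injOn
    simp only [Set.mem_univ, and_true, Set.ofPred_mem_eq] at himg
    rw [himg]
    exact finite_gridSet (idealPowBasis w a) (fun i => (w i : ℕ))
      ((isBounded_weightedNormLeOne w).subset Set.inter_subset_left) ht
  refine hfin.subset fun x hx => ⟨hx.1, hx.2.1, hx.2.2.trans ?_⟩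
  exact mul_le_mul_of_nonneg_right (le_max_left _ _) (absNorm_pos a).le

theorem volumeReal_fundamentalDomain_idealPowBasis (a : (FractionalIdeal (𝓞 K)⁰ K)ˣ)
    (i : Fin (n + 1)) :
    volume.real (ZSpan.fundamentalDomain (idealPowBasis w a i)) =
      ((FractionalIdeal.absNorm (a : FractionalIdeal (𝓞 K)⁰ K) : ℚ) : ℝ) ^ (w i : ℕ) *
        ((2⁻¹) ^ nrComplexPlaces K * √|(discr K : ℝ)|) := by
  rw [← ZLattice.covolume_eq_measure_fundamentalDomain _ volume
    (fundamentalDomain_idealLattice K _), covolume_idealLattice, Units.val_pow_eq_pow_val, map_pow]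
  push_cast
  rw [mul_assoc]

/-- The limit does not depend on `a`: the covolumes of the `a ^ w i` contribute `N(a) ^ |w|`, which
cancels the same factor in `(X * N(a)) ^ |w|`. -/
theorem tendsto_ncard_coneTuples_inter (a : (FractionalIdeal (𝓞 K)⁰ K)ˣ)
    {Z : Set (Fin (n + 1) → mixedSpace K)}
    (hZ : ∀ t : ℝ, 0 < t → ∀ y, (fun i => (t ^ (w i : ℕ))⁻¹ • y i) ∈ Z ↔ y ∈ Z)
    (hZm : MeasurableSet Z) (hfr : volume (frontier (weightedNormLeOne w K ∩ Z)) = 0) :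
    Tendsto (fun X : ℝ =>
        ({x | x ∈ coneTuples w a X ∧ tupleEmbedding x ∈ Z}.ncard : ℝ) / X ^ weightSum w) atTop
      (𝓝 (volume.real (weightedNormLeOne w K ∩ Z) /
        ((2⁻¹) ^ nrComplexPlaces K * √|(discr K : ℝ)|) ^ (n + 1))) := by
  have hd : finrank ℝ (mixedSpace K) ≠ 0 := finrank_pos.ne'
  have hN := absNorm_pos a
  set N : ℝ := ((FractionalIdeal.absNorm (a : FractionalIdeal (𝓞 K)⁰ K) : ℚ) : ℝ) with hNdef
  have h1 := tendsto_ncard_gridSet (idealPowBasis w a) (fun i => (w i : ℕ)) (fun i => (w i).pos)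
    ((isBounded_weightedNormLeOne w).subset Set.inter_subset_left)
    ((measurableSet_weightedNormLeOne w).inter hZm) hfr
  have ht : Tendsto (fun X : ℝ => (X * N) ^ ((finrank ℝ (mixedSpace K) : ℝ)⁻¹)) atTop atTop :=
    (tendsto_rpow_atTop (by positivity)).comp (tendsto_id.atTop_mul_const hN)
  have h2 := (h1.comp ht).mul_const (N ^ weightSum w)
  have hlim : volume.real (weightedNormLeOne w K ∩ Z) /
      (∏ i, volume.real (ZSpan.fundamentalDomain (idealPowBasis w a i))) * N ^ weightSum w =
      volume.real (weightedNormLeOne w K ∩ Z) /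
        ((2⁻¹) ^ nrComplexPlaces K * √|(discr K : ℝ)|) ^ (n + 1) := by
    simp_rw [volumeReal_fundamentalDomain_idealPowBasis]
    rw [Finset.prod_mul_distrib, Finset.prod_pow_eq_pow_sum, Finset.prod_const, Finset.card_univ,
      Fintype.card_fin, ← hNdef, weightSum, div_mul_eq_mul_div, mul_comm (volume.real _),
      mul_div_mul_left _ _ (by positivity)]
  rw [hlim] at h2
  refine h2.congr' ?_
  filter_upwards [eventually_gt_atTop 0] with X hX
  have htX : ((X * N) ^ ((finrank ℝ (mixedSpace K) : ℝ)⁻¹)) ^ finrank ℝ (mixedSpace K) = X * N :=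
    Real.rpow_inv_natCast_pow (by positivity) hd
  rw [Function.comp_apply, ← image_tupleEmbedding_coneTuples w a hZ
    (Real.rpow_pos_of_pos (by positivity) _) htX,
    Set.ncard_image_of_injective _ tupleEmbedding_injective, htX]
  change _ / (X * N) ^ weightSum w * _ = _
  rw [mul_pow, div_mul_eq_mul_div, mul_div_mul_right _ _ (by positivity)]

/-- The limit of the number of elements of `coneTuples w a X` divided by `X ^ weightSum w`. -/
def coneLimit (K : Type*) [Field K] [NumberField K] : ℝ :=
  regulator K * ((2 ^ nrRealPlaces K * (2 * Real.pi) ^ nrComplexPlaces K) /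
    √|(discr K : ℝ)|) ^ (n + 1) * (weightSum w : ℝ) ^ rank K

theorem tendsto_ncard_coneTuples (a : (FractionalIdeal (𝓞 K)⁰ K)ˣ) :
    Tendsto (fun X : ℝ => ((coneTuples w a X).ncard : ℝ) / X ^ weightSum w) atTop
      (𝓝 (coneLimit w K)) := by
  have h := tendsto_ncard_coneTuples_inter w a (Z := Set.univ) (by simp) MeasurableSet.univ
    (by rw [Set.inter_univ]; exact volume_frontier_weightedNormLeOne w)
  simp only [Set.mem_univ, and_true, Set.ofPred_mem_eq, Set.inter_univ] at h
  convert h using 2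
  have hd : (0 : ℝ) < √|(discr K : ℝ)| :=
    Real.sqrt_pos.mpr (abs_pos.mpr (Int.cast_ne_zero.mpr (discr_ne_zero K)))
  have hq : (2 : ℝ) ^ nrRealPlaces K * (2 * Real.pi) ^ nrComplexPlaces K / √|(discr K : ℝ)| =
      2 ^ nrRealPlaces K * Real.pi ^ nrComplexPlaces K /
        ((2⁻¹) ^ nrComplexPlaces K * √|(discr K : ℝ)|) := by
    rw [mul_pow, inv_pow]
    field_simp
  rw [coneLimit, volumeReal_weightedNormLeOne, hq, div_pow]
  ring

/-- A coordinate hyperplane is closed and null, so it contains both the region and its frontier with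
volume zero. These are the vectors that may have too large a stabiliser among the roots of unity. -/
theorem tendsto_ncard_coneTuples_eq_zero (a : (FractionalIdeal (𝓞 K)⁰ K)ˣ) (j : Fin (n + 1)) :
    Tendsto (fun X : ℝ => ({x | x ∈ coneTuples w a X ∧ x j = 0}.ncard : ℝ) / X ^ weightSum w)
      atTop (𝓝 0) := by
  have hcl : IsClosed {y : Fin (n + 1) → mixedSpace K | y j = 0} :=
    isClosed_eq (continuous_apply j) continuous_const
  have hnull : volume {y : Fin (n + 1) → mixedSpace K | y j = 0} = 0 := by
    have : {y : Fin (n + 1) → mixedSpace K | y j = 0} =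
        Set.univ.pi (Function.update (fun _ => Set.univ) j {0}) := by
      ext y
      simp [Set.mem_pi, Function.update_apply]
    rw [this, volume_pi_pi]
    exact Finset.prod_eq_zero (Finset.mem_univ j) (by simp)
  have h := tendsto_ncard_coneTuples_inter w a (Z := {y | y j = 0})
    (fun t ht y => by simp [ht.ne']) hcl.measurableSet (measure_mono_null
      (frontier_subset_closure.trans (closure_minimal Set.inter_subset_right hcl)) hnull)
  rw [measureReal_def, measure_mono_null Set.inter_subset_right hnull, ENNReal.toReal_zero,
    zero_div] at h
  simpa [tupleEmbedding] using h

end IdealCount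

/-! ### The scaling ideal is attained and invertible -/

section ScalingIdeal

variable {K : Type*} [Field K] [NumberField K]

/-- Take `c = (a⁻¹ + b⁻¹)⁻¹`. The integral ideals `I = c * a⁻¹` and `J = c * b⁻¹` are coprime, hence
so are `I ^ m` and `J ^ m`; both multiply `x` into `c ^ m`, and their sum is the unit ideal. -/
theorem exists_le_and_mem_pow (a b : (FractionalIdeal (𝓞 K)⁰ K)ˣ) :
    ∃ c : (FractionalIdeal (𝓞 K)⁰ K)ˣ, (c : FractionalIdeal (𝓞 K)⁰ K) ≤ a ∧
      (c : FractionalIdeal (𝓞 K)⁰ K) ≤ b ∧ ∀ (m : ℕ) (x : K),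
        x ∈ (a : FractionalIdeal (𝓞 K)⁰ K) ^ m → x ∈ (b : FractionalIdeal (𝓞 K)⁰ K) ^ m →
          x ∈ (c : FractionalIdeal (𝓞 K)⁰ K) ^ m := by
  have hmul : ∀ {I J : FractionalIdeal (𝓞 K)⁰ K} (L : FractionalIdeal (𝓞 K)⁰ K), I ≤ J →
      L * I ≤ L * J := fun L h => mul_le_mul_right h L
  have hne : ((a⁻¹ : (FractionalIdeal (𝓞 K)⁰ K)ˣ) : FractionalIdeal (𝓞 K)⁰ K) +
      ((b⁻¹ : (FractionalIdeal (𝓞 K)⁰ K)ˣ) : FractionalIdeal (𝓞 K)⁰ K) ≠ 0 := by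
    intro h
    have h1 := le_self_add.trans h.le
    exact (a⁻¹).ne_zero (le_antisymm h1 (FractionalIdeal.zero_le _))
  set e := Units.mk0 _ hne with he
  have hle : ∀ u : (FractionalIdeal (𝓞 K)⁰ K)ˣ,
      ((u⁻¹ : (FractionalIdeal (𝓞 K)⁰ K)ˣ) : FractionalIdeal (𝓞 K)⁰ K) ≤ e →
      ((e⁻¹ * u⁻¹ : (FractionalIdeal (𝓞 K)⁰ K)ˣ) : FractionalIdeal (𝓞 K)⁰ K) ≤ 1 := by
    intro u hu
    have := hmul ((e⁻¹ : (FractionalIdeal (𝓞 K)⁰ K)ˣ) : FractionalIdeal (𝓞 K)⁰ K) hu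
    rwa [Units.inv_mul, ← Units.val_mul] at this
  have hae : ((a⁻¹ : (FractionalIdeal (𝓞 K)⁰ K)ˣ) : FractionalIdeal (𝓞 K)⁰ K) ≤ e := le_self_add
  have hbe : ((b⁻¹ : (FractionalIdeal (𝓞 K)⁰ K)ˣ) : FractionalIdeal (𝓞 K)⁰ K) ≤ e := le_add_self
  have hle' : ∀ u : (FractionalIdeal (𝓞 K)⁰ K)ˣ,
      ((e⁻¹ * u⁻¹ : (FractionalIdeal (𝓞 K)⁰ K)ˣ) : FractionalIdeal (𝓞 K)⁰ K) ≤ 1 →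
      ((e⁻¹ : (FractionalIdeal (𝓞 K)⁰ K)ˣ) : FractionalIdeal (𝓞 K)⁰ K) ≤ u := by
    intro u hu
    have := hmul (u : FractionalIdeal (𝓞 K)⁰ K) hu
    rwa [← Units.val_mul, mul_comm, inv_mul_cancel_right, mul_one] at this
  refine ⟨e⁻¹, hle' a (hle a hae), hle' b (hle b hbe), fun m x hxa hxb => ?_⟩
  obtain ⟨I, hI⟩ := FractionalIdeal.le_one_iff_exists_coeIdeal.mp (hle a hae)
  obtain ⟨J, hJ⟩ := FractionalIdeal.le_one_iff_exists_coeIdeal.mp (hle b hbe)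
  have hIJ : I ⊔ J = ⊤ := by
    have h1 : ((I ⊔ J : Ideal (𝓞 K)) : FractionalIdeal (𝓞 K)⁰ K) = 1 := by
      rw [FractionalIdeal.coeIdeal_sup, hI, hJ, Units.val_mul, Units.val_mul, ← mul_add]
      exact e.inv_mul
    rwa [← FractionalIdeal.coeIdeal_top, FractionalIdeal.coeIdeal_inj] at h1
  have hIJm : (I : FractionalIdeal (𝓞 K)⁰ K) ^ m + (J : FractionalIdeal (𝓞 K)⁰ K) ^ m = 1 := by
    have := Ideal.pow_sup_pow_eq_top (m := m) (n := m) hIJ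
    rw [← FractionalIdeal.coeIdeal_pow, ← FractionalIdeal.coeIdeal_pow,
      ← FractionalIdeal.coeIdeal_sup, this,
      FractionalIdeal.coeIdeal_top]
  have hstep : ∀ (u : (FractionalIdeal (𝓞 K)⁰ K)ˣ) (L : Ideal (𝓞 K)),
      (L : FractionalIdeal (𝓞 K)⁰ K) = ((e⁻¹ * u⁻¹ : (FractionalIdeal (𝓞 K)⁰ K)ˣ)) →
      x ∈ (u : FractionalIdeal (𝓞 K)⁰ K) ^ m →
      (L : FractionalIdeal (𝓞 K)⁰ K) ^ m * FractionalIdeal.spanSingleton (𝓞 K)⁰ x ≤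
        ((e⁻¹ : (FractionalIdeal (𝓞 K)⁰ K)ˣ) : FractionalIdeal (𝓞 K)⁰ K) ^ m := by
    intro u L hL hx
    have := hmul ((L : FractionalIdeal (𝓞 K)⁰ K) ^ m)
      (FractionalIdeal.spanSingleton_le_iff_mem.mpr hx)
    refine this.trans (le_of_eq ?_)
    rw [← mul_pow, hL, ← Units.val_mul, inv_mul_cancel_right]
  rw [← FractionalIdeal.spanSingleton_le_iff_mem, ← one_mul (FractionalIdeal.spanSingleton _ x),
    ← hIJm, add_mul, ← FractionalIdeal.sup_eq_add]
  exact sup_le (hstep a I hI hxa) (hstep b J hJ hxb)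

variable {n : ℕ} (w : Fin (n + 1) → ℕ+)

theorem ne_zero_of_forall_mem_pow {x : Fin (n + 1) → K} (hx : x ≠ 0)
    {a : FractionalIdeal (𝓞 K)⁰ K} (ha : ∀ i, x i ∈ a ^ (w i : ℕ)) : a ≠ 0 := by
  rintro rfl
  refine hx (funext fun i => ?_)
  have := ha i
  rwa [zero_pow (w i).ne_zero, FractionalIdeal.mem_zero_iff] at this

theorem absNorm_pow_le {x : K} (hx : x ≠ 0) {a : FractionalIdeal (𝓞 K)⁰ K} {m : ℕ}
    (ha : x ∈ a ^ m) (ha0 : a ≠ 0) : FractionalIdeal.absNorm a ^ m ≤ |Algebra.norm ℚ x| := by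
  have hle := FractionalIdeal.spanSingleton_le_iff_mem.mpr ha
  have ham : a ^ m ≠ 0 := pow_ne_zero _ ha0
  have h1 : (a ^ m)⁻¹ * FractionalIdeal.spanSingleton (𝓞 K)⁰ x ≤ 1 := by
    have := mul_le_mul_right hle (a ^ m)⁻¹
    rwa [inv_mul_cancel₀ ham] at this
  obtain ⟨J, hJ⟩ := FractionalIdeal.le_one_iff_exists_coeIdeal.mp h1
  have h2 : FractionalIdeal.spanSingleton (𝓞 K)⁰ x = a ^ m * J := by
    rw [hJ, mul_inv_cancel_left₀ ham]
  have hJ0 : J ≠ ⊥ := by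
    rintro rfl
    rw [FractionalIdeal.coeIdeal_bot, mul_zero, FractionalIdeal.spanSingleton_eq_zero_iff] at h2
    exact hx h2
  rw [← FractionalIdeal.absNorm_span_singleton (R := 𝓞 K), h2, map_mul, map_pow,
    FractionalIdeal.coeIdeal_absNorm]
  have : (1 : ℚ) ≤ Ideal.absNorm J := by
    exact_mod_cast Nat.one_le_iff_ne_zero.mpr fun h => hJ0 (Ideal.absNorm_eq_zero_iff.mp h)
  exact le_mul_of_one_le_right (pow_nonneg (FractionalIdeal.absNorm_nonneg a) _) this

/-- Below an admissible `a` there are only finitely many admissible `a * J`, as a nonzero coordinate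
bounds their norms; take a minimal one. For any admissible `b`, the previous construction gives an
admissible ideal below both. It has the form `a * J'` with `J' ≤ J`, so minimality makes it equal to
`a * J`, which is therefore least. -/
theorem exists_unit_eq_scalingIdeal {x : Fin (n + 1) → K} (hx : x ≠ 0) :
    ∃ c : (FractionalIdeal (𝓞 K)⁰ K)ˣ, (c : FractionalIdeal (𝓞 K)⁰ K) = scalingIdeal w x ∧
      ∀ i, x i ∈ (c : FractionalIdeal (𝓞 K)⁰ K) ^ (w i : ℕ) := by
  obtain ⟨a, ha⟩ := exists_scaling w x
  have ha0 := ne_zero_of_forall_mem_pow w hx ha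
  have hNa : 0 < FractionalIdeal.absNorm a :=
    lt_of_le_of_ne (FractionalIdeal.absNorm_nonneg a)
      fun h => ha0 (FractionalIdeal.absNorm_eq_zero_iff.mp h.symm)
  obtain ⟨i, hi⟩ := Function.ne_iff.mp hx
  let S : Set (Ideal (𝓞 K)) := {J | ∀ i, x i ∈ (a * (J : FractionalIdeal (𝓞 K)⁰ K)) ^ (w i : ℕ)}
  have hSfin : S.Finite := by
    -- From `N(a * J) ^ w i ≤ |N(x i)|` follows `N(a * J) ≤ 1 + |N(x i)|`, which avoids taking
    -- roots.
    refine (Ideal.finite_setOfPred_absNorm_le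
      ⌊(1 + |Algebra.norm ℚ (x i)|) / FractionalIdeal.absNorm a⌋₊).subset fun J hJ => ?_
    have hnn : 0 ≤ FractionalIdeal.absNorm (a * (J : FractionalIdeal (𝓞 K)⁰ K)) :=
      FractionalIdeal.absNorm_nonneg _
    have h1 := absNorm_pow_le hi (hJ i) (ne_zero_of_forall_mem_pow w hx hJ)
    have h2 : FractionalIdeal.absNorm (a * (J : FractionalIdeal (𝓞 K)⁰ K)) ≤
        1 + |Algebra.norm ℚ (x i)| := by
      rcases le_total (FractionalIdeal.absNorm (a * (J : FractionalIdeal (𝓞 K)⁰ K))) 1 with h | h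
      · linarith [abs_nonneg (Algebra.norm ℚ (x i))]
      · linarith [le_self_pow₀ h (w i).ne_zero]
    rw [Set.mem_ofPred_eq]
    refine Nat.le_floor ?_
    rw [le_div_iff₀' hNa, ← FractionalIdeal.coeIdeal_absNorm (K := K), ← map_mul]
    exact h2
  have hSne : S.Nonempty := ⟨⊤, fun i => by
    rw [FractionalIdeal.coeIdeal_top, mul_one]; exact ha i⟩
  obtain ⟨J, hJ⟩ := hSfin.exists_minimal hSne
  have hc0 := ne_zero_of_forall_mem_pow w hx hJ.1
  refine ⟨Units.mk0 _ hc0, ?_, hJ.1⟩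
  refine le_antisymm ?_ ?_
  · rw [le_scalingIdeal_iff]
    intro b hb
    have hb0 := ne_zero_of_forall_mem_pow w hx hb
    obtain ⟨c, hca, hcb, hc⟩ := exists_le_and_mem_pow (Units.mk0 _ hc0) (Units.mk0 _ hb0)
    rw [Units.val_mk0] at hca hcb
    have hmem : ∀ i, x i ∈ (c : FractionalIdeal (𝓞 K)⁰ K) ^ (w i : ℕ) :=
      fun i => hc _ _ (hJ.1 i) (hb i)
    have hinv : ∀ I : FractionalIdeal (𝓞 K)⁰ K, a⁻¹ * (a * I) = I := fun I =>
      inv_mul_cancel_left₀ ha0 I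
    have h1 : a⁻¹ * (c : FractionalIdeal (𝓞 K)⁰ K) ≤ J := by
      have := mul_le_mul_right hca a⁻¹
      rwa [hinv] at this
    obtain ⟨J', hJ'⟩ := FractionalIdeal.le_one_iff_exists_coeIdeal.mp
      (h1.trans FractionalIdeal.coeIdeal_le_one)
    have hcJ : (c : FractionalIdeal (𝓞 K)⁰ K) = a * J' := by
      rw [hJ', mul_inv_cancel_left₀ ha0]
    have hJ'S : J' ∈ S := fun i => by rw [← hcJ]; exact hmem i
    have hle : J' ≤ J := by
      rw [← hJ', FractionalIdeal.coeIdeal_le_coeIdeal] at h1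
      exact h1
    have := hJ.2 hJ'S hle
    rw [Units.val_mk0]
    refine le_trans ?_ hcb
    rw [hcJ]
    exact mul_le_mul_right ((FractionalIdeal.coeIdeal_le_coeIdeal K).mpr this) a
  · exact (le_scalingIdeal_iff w x _).mp le_rfl _ hJ.1

/-- The scaling ideal of a nonzero tuple as an invertible fractional ideal. -/
def scalingUnit (x : NonzeroVec n K) : (FractionalIdeal (𝓞 K)⁰ K)ˣ :=
  (exists_unit_eq_scalingIdeal w x.2).choose

theorem coe_scalingUnit (x : NonzeroVec n K) :
    (scalingUnit w x : FractionalIdeal (𝓞 K)⁰ K) = scalingIdeal w x.1 :=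
  (exists_unit_eq_scalingIdeal w x.2).choose_spec.1

/-- Replaces the coordinatewise conditions by one inclusion of ideals, that is, a divisibility. -/
theorem forall_mem_pow_iff (x : NonzeroVec n K) (a : FractionalIdeal (𝓞 K)⁰ K) :
    (∀ i, x.1 i ∈ a ^ (w i : ℕ)) ↔ (scalingUnit w x : FractionalIdeal (𝓞 K)⁰ K) ≤ a := by
  constructor
  · intro h
    rw [coe_scalingUnit]
    exact (le_scalingIdeal_iff w x.1 _).mp le_rfl a h
  · intro h i
    exact (FractionalIdeal.coe_le_coe.mpr (pow_le_pow_left' h _))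
      ((exists_unit_eq_scalingIdeal w x.2).choose_spec.2 i)

end ScalingIdeal

/-! ### Action of units and principal ideals on vectors -/

section Combinatorics

open NumberField.mixedEmbedding NumberField.InfinitePlace
open NumberField.mixedEmbedding.fundamentalCone NumberField.Units
open scoped Classical

variable {n : ℕ} (w : Fin (n + 1) → ℕ+) {K : Type*} [Field K]

/-- The weighted action of `Kˣ` on nonzero vectors. -/
def weightedSMul (c : Kˣ) (x : NonzeroVec n K) : NonzeroVec n K :=
  ⟨fun i => (c : K) ^ (w i : ℕ) * x.1 i, fun h => x.2 (funext fun i => by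
    have := congrFun h i
    simpa using this)⟩

theorem weightedSMul_apply (c : Kˣ) (x : NonzeroVec n K) (i : Fin (n + 1)) :
    (weightedSMul w c x).1 i = (c : K) ^ (w i : ℕ) * x.1 i := rfl

variable {w} in
theorem exists_eq_weightedSMul {x y : NonzeroVec n K}
    (h : (Quotient.mk (orbitSetoid w K) x : Point w K) = Quotient.mk (orbitSetoid w K) y) :
    ∃ c : Kˣ, y = weightedSMul w c x := by
  obtain ⟨c, hc⟩ := Quotient.exact h
  exact ⟨c, Subtype.ext (funext hc)⟩

theorem mk_weightedSMul (c : Kˣ) (x : NonzeroVec n K) :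
    (Quotient.mk (orbitSetoid w K) (weightedSMul w c x) : Point w K) =
      Quotient.mk (orbitSetoid w K) x :=
  Quotient.sound ((orbitSetoid w K).symm ⟨c, fun _ => rfl⟩)

/-- A unit of the ring of integers as a unit of the field. -/
def unitToField (u : (𝓞 K)ˣ) : Kˣ := Units.map (algebraMap (𝓞 K) K) u

theorem coe_unitToField (u : (𝓞 K)ˣ) : (unitToField u : K) = (u : K) := rfl

theorem weightedNorm_weightedSMul (c : Kˣ) (x : NonzeroVec n K) (v : InfinitePlace K) :
    weightedNorm w (tupleEmbedding (weightedSMul w c x).1) v =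
      v (c : K) * weightedNorm w (tupleEmbedding x.1) v := by
  rw [← weightedNorm_mul_apply]
  congr 2
  ext1 i
  rw [tupleEmbedding, weightedSMul_apply, map_mul, map_pow]
  rfl

theorem weightedNorm_pos (x : NonzeroVec n K) (v : InfinitePlace K) :
    0 < weightedNorm w (tupleEmbedding x.1) v := by
  obtain ⟨i, hi⟩ := Function.ne_iff.mp x.2
  refine lt_of_lt_of_le ?_ (rpow_le_weightedNorm w (tupleEmbedding x.1) v i)
  rw [tupleEmbedding, normAtPlace_apply]
  exact Real.rpow_pos_of_pos (v.pos_iff.mpr hi) _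

variable [NumberField K]

theorem toPrincipalIdeal_unitToField (u : (𝓞 K)ˣ) :
    toPrincipalIdeal (𝓞 K) K (unitToField u) = 1 := by
  rw [toPrincipalIdeal_eq_iff, Units.val_one, coe_unitToField,
    ← FractionalIdeal.coeIdeal_span_singleton, Ideal.span_singleton_eq_top.mpr u.isUnit,
    FractionalIdeal.coeIdeal_top]

theorem exists_unit_of_toPrincipalIdeal_eq_one {c : Kˣ}
    (h : toPrincipalIdeal (𝓞 K) K c = 1) : ∃ u : (𝓞 K)ˣ, unitToField u = c := by
  have key : ∀ d : Kˣ, toPrincipalIdeal (𝓞 K) K d = 1 → ∃ y : 𝓞 K, algebraMap (𝓞 K) K y = d := by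
    intro d hd
    rw [toPrincipalIdeal_eq_iff, Units.val_one] at hd
    have := FractionalIdeal.mem_spanSingleton_self (𝓞 K)⁰ (d : K)
    rwa [hd, FractionalIdeal.mem_one_iff] at this
  obtain ⟨y, hy⟩ := key c h
  obtain ⟨z, hz⟩ := key c⁻¹ (by rw [map_inv, h, inv_one])
  have hyz : y * z = 1 := by
    apply FaithfulSMul.algebraMap_injective (𝓞 K) K
    rw [map_mul, hy, hz, map_one, Units.mul_inv]
  exact ⟨Units.mkOfMulEqOne y z hyz, Units.ext hy⟩

theorem scalingUnit_weightedSMul (c : Kˣ) (x : NonzeroVec n K) :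
    scalingUnit w (weightedSMul w c x) = toPrincipalIdeal (𝓞 K) K c * scalingUnit w x := by
  ext1
  rw [Units.val_mul, coe_scalingUnit, coe_scalingUnit, coe_toPrincipalIdeal]
  exact scalingIdeal_smul w c _ _ fun _ => rfl

/-- Whether the weighted norms of a vector are those of an element of the fundamental cone. -/
def InCone (x : Fin (n + 1) → K) : Prop :=
  mixedSpaceOfRealSpace (weightedNorm w (tupleEmbedding x)) ∈ fundamentalCone K

/-- The roots of order `w i` make the weighted norm homogeneous of degree one, so a unit acts on it
by ordinary multiplication and the fundamental cone for the usual unit action applies. -/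
theorem inCone_weightedSMul_iff (u : (𝓞 K)ˣ) (x : NonzeroVec n K) :
    InCone w (weightedSMul w (unitToField u) x).1 ↔
      u • mixedSpaceOfRealSpace (weightedNorm w (tupleEmbedding x.1)) ∈ fundamentalCone K := by
  have : ∀ v, normAtPlace v (mixedSpaceOfRealSpace
      (weightedNorm w (tupleEmbedding (weightedSMul w (unitToField u) x).1))) =
      normAtPlace v (u • mixedSpaceOfRealSpace (weightedNorm w (tupleEmbedding x.1))) := fun v => by
    rw [normAtPlace_mixedSpaceOfRealSpace (weightedNorm_nonneg w _ v), weightedNorm_weightedSMul,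
      unitSMul_smul, map_mul, normAtPlace_apply,
      normAtPlace_mixedSpaceOfRealSpace (weightedNorm_nonneg w _ v)]
    rfl
  exact ⟨fun h => mem_of_normAtPlace_eq h fun v => (this v).symm,
    fun h => mem_of_normAtPlace_eq h this⟩

theorem archSize_pos (x : NonzeroVec n K) : 0 < archSize w x.1 := by
  rw [archSize_eq_norm, norm_mixedSpaceOfRealSpace (weightedNorm_nonneg w _)]
  exact Finset.prod_pos fun v _ => pow_pos (weightedNorm_pos w x v) _

theorem exists_unit_inCone (x : NonzeroVec n K) :
    ∃ u : (𝓞 K)ˣ, InCone w (weightedSMul w (unitToField u) x).1 := by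
  simp_rw [inCone_weightedSMul_iff]
  refine exists_unit_smul_mem ?_
  rw [← archSize_eq_norm]
  exact (archSize_pos w x).ne'

theorem inCone_weightedSMul_iff_mem_torsion {x : NonzeroVec n K} (hx : InCone w x.1)
    (u : (𝓞 K)ˣ) : InCone w (weightedSMul w (unitToField u) x).1 ↔ u ∈ torsion K := by
  rw [inCone_weightedSMul_iff]
  exact unit_smul_mem_iff_mem_torsion hx u

theorem size_mk (x : NonzeroVec n K) :
    size w (Quotient.mk (orbitSetoid w K) x) =
      ((FractionalIdeal.absNorm (scalingUnit w x : FractionalIdeal (𝓞 K)⁰ K) : ℚ) : ℝ)⁻¹ *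
        archSize w x.1 := by
  rw [coe_scalingUnit]
  rfl

theorem size_pos (p : Point w K) : 0 < size w p := by
  induction p using Quotient.inductionOn with
  | h x =>
    rw [size_mk]
    exact mul_pos (inv_pos.mpr (absNorm_pos _)) (archSize_pos w x)

/-- A fractional ideal in a given ideal class. -/
def classRep (C : ClassGroup (𝓞 K)) : (FractionalIdeal (𝓞 K)⁰ K)ˣ := (ClassGroup.equiv K C).out

theorem mk_classRep (C : ClassGroup (𝓞 K)) :
    (QuotientGroup.mk (classRep C) : (FractionalIdeal (𝓞 K)⁰ K)ˣ ⧸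
      (toPrincipalIdeal (𝓞 K) K).range) = ClassGroup.equiv K C :=
  QuotientGroup.out_eq' _

theorem classRep_eq_of_mul {C C' : ClassGroup (𝓞 K)} {c : Kˣ}
    (h : classRep C' = toPrincipalIdeal (𝓞 K) K c * classRep C) : C' = C := by
  refine (ClassGroup.equiv K).injective ?_
  rw [← mk_classRep, ← mk_classRep, eq_comm, QuotientGroup.eq, h, mul_comm, mul_inv_cancel_right]
  exact ⟨c, rfl⟩

theorem exists_classRep_eq (a : (FractionalIdeal (𝓞 K)⁰ K)ˣ) :
    ∃ (C : ClassGroup (𝓞 K)) (c : Kˣ), classRep C = toPrincipalIdeal (𝓞 K) K c * a := by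
  refine ⟨(ClassGroup.equiv K).symm (QuotientGroup.mk a), ?_⟩
  have h := mk_classRep ((ClassGroup.equiv K).symm (QuotientGroup.mk a))
  rw [MulEquiv.apply_symm_apply, eq_comm, QuotientGroup.eq] at h
  obtain ⟨c, hc⟩ := h
  exact ⟨c, by rw [hc, mul_comm, mul_inv_cancel_left]⟩

end Combinatorics

/-! ### Counting pairs of an ideal and a point -/

section PairCount

open NumberField.mixedEmbedding NumberField.InfinitePlace
open NumberField.mixedEmbedding.fundamentalCone NumberField.Units
open scoped Classical Topology

variable {n : ℕ} (w : Fin (n + 1) → ℕ+) {K : Type*} [Field K] [NumberField K]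

/-- The pairs of a nonzero integral ideal `b` and a point `p` with `N(b) * size p ≤ X`. -/
def idealPointPairs (X : ℝ) : Set ((Ideal (𝓞 K))⁰ × Point w K) :=
  {q | (Ideal.absNorm (q.1 : Ideal (𝓞 K)) : ℝ) * size w q.2 ≤ X}

/-- The pairs of an ideal class and a vector of `coneTuples` for its representative. -/
def coneVectors (X : ℝ) : Set (ClassGroup (𝓞 K) × NonzeroVec n K) :=
  {z | z.2.1 ∈ coneTuples w (classRep z.1) X}

theorem exists_scalingUnit_eq_mul {C : ClassGroup (𝓞 K)} {x : NonzeroVec n K}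
    (h : ∀ i, x.1 i ∈ (classRep C : FractionalIdeal (𝓞 K)⁰ K) ^ (w i : ℕ)) :
    ∃ b : (Ideal (𝓞 K))⁰, scalingUnit w x = classRep C * FractionalIdeal.mk0 K b := by
  rw [forall_mem_pow_iff] at h
  have h1 : (((classRep C)⁻¹ * scalingUnit w x : (FractionalIdeal (𝓞 K)⁰ K)ˣ) :
      FractionalIdeal (𝓞 K)⁰ K) ≤ 1 := by
    have := mul_le_mul_right h (((classRep C)⁻¹ : (FractionalIdeal (𝓞 K)⁰ K)ˣ) :
      FractionalIdeal (𝓞 K)⁰ K)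
    rwa [Units.inv_mul, ← Units.val_mul] at this
  obtain ⟨b, hb⟩ := FractionalIdeal.le_one_iff_exists_coeIdeal.mp h1
  have hb0 : b ≠ 0 := by
    rintro rfl
    rw [Ideal.zero_eq_bot, FractionalIdeal.coeIdeal_bot] at hb
    exact Units.ne_zero _ hb.symm
  refine ⟨⟨b, mem_nonZeroDivisors_of_ne_zero hb0⟩, ?_⟩
  rw [← inv_mul_eq_iff_eq_mul]
  ext1
  rw [← hb, FractionalIdeal.coe_mk0]

/-- The quotient of the scaling ideal of `x` by the representative of the ideal class `C`. -/
def scalingQuotient (z : ClassGroup (𝓞 K) × NonzeroVec n K) : (Ideal (𝓞 K))⁰ :=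
  if h : ∃ b : (Ideal (𝓞 K))⁰, scalingUnit w z.2 = classRep z.1 * FractionalIdeal.mk0 K b
  then h.choose else 1

/-- The pair of an integral ideal and a point attached to an element of `coneVectors`. -/
def toPair (z : ClassGroup (𝓞 K) × NonzeroVec n K) : (Ideal (𝓞 K))⁰ × Point w K :=
  (scalingQuotient w z, Quotient.mk (orbitSetoid w K) z.2)

variable {w}

theorem mk0_injective : Function.Injective (FractionalIdeal.mk0 K : (Ideal (𝓞 K))⁰ → _) := by
  intro a b h
  have := congrArg (Units.val) h
  rw [FractionalIdeal.coe_mk0, FractionalIdeal.coe_mk0, FractionalIdeal.coeIdeal_inj] at this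
  exact Subtype.ext this

theorem scalingUnit_eq_classRep_mul {z : ClassGroup (𝓞 K) × NonzeroVec n K}
    (h : ∀ i, z.2.1 i ∈ (classRep z.1 : FractionalIdeal (𝓞 K)⁰ K) ^ (w i : ℕ)) :
    scalingUnit w z.2 = classRep z.1 * FractionalIdeal.mk0 K (scalingQuotient w z) := by
  have hex := exists_scalingUnit_eq_mul w h
  rw [scalingQuotient, dif_pos hex]
  exact hex.choose_spec

theorem scalingQuotient_eq {z : ClassGroup (𝓞 K) × NonzeroVec n K} {b : (Ideal (𝓞 K))⁰}
    (h : scalingUnit w z.2 = classRep z.1 * FractionalIdeal.mk0 K b) :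
    scalingQuotient w z = b := by
  have hex : ∃ b : (Ideal (𝓞 K))⁰,
    scalingUnit w z.2 = classRep z.1 * FractionalIdeal.mk0 K b := ⟨b, h⟩
  rw [scalingQuotient, dif_pos hex]
  exact mk0_injective (mul_left_cancel (hex.choose_spec.symm.trans h))

theorem forall_mem_classRep_pow {z : ClassGroup (𝓞 K) × NonzeroVec n K} {b : (Ideal (𝓞 K))⁰}
    (h : scalingUnit w z.2 = classRep z.1 * FractionalIdeal.mk0 K b) (i : Fin (n + 1)) :
    z.2.1 i ∈ (classRep z.1 : FractionalIdeal (𝓞 K)⁰ K) ^ (w i : ℕ) := by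
  revert i
  rw [forall_mem_pow_iff, h, Units.val_mul, FractionalIdeal.coe_mk0]
  have hb : ((b : Ideal (𝓞 K)) : FractionalIdeal (𝓞 K)⁰ K) ≤ 1 := FractionalIdeal.coeIdeal_le_one
  have := mul_le_mul_right hb (classRep z.1 : FractionalIdeal (𝓞 K)⁰ K)
  rwa [mul_one] at this

theorem absNorm_mul_size_le_iff {z : ClassGroup (𝓞 K) × NonzeroVec n K} {b : (Ideal (𝓞 K))⁰}
    (h : scalingUnit w z.2 = classRep z.1 * FractionalIdeal.mk0 K b) (X : ℝ) :
    (Ideal.absNorm (b : Ideal (𝓞 K)) : ℝ) * size w (Quotient.mk (orbitSetoid w K) z.2) ≤ X ↔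
      archSize w z.2.1 ≤ X *
        (FractionalIdeal.absNorm (classRep z.1 : FractionalIdeal (𝓞 K)⁰ K) : ℚ) := by
  have hN := absNorm_pos (classRep z.1)
  have hb : (0 : ℝ) < Ideal.absNorm (b : Ideal (𝓞 K)) := by
    exact_mod_cast Ideal.absNorm_pos_of_nonZeroDivisors b
  rw [size_mk, h, Units.val_mul, map_mul, FractionalIdeal.coe_mk0, FractionalIdeal.coeIdeal_absNorm]
  push_cast
  rw [mul_inv, mul_comm (_⁻¹) ((Ideal.absNorm (b : Ideal (𝓞 K)) : ℝ)⁻¹), mul_assoc,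
    mul_inv_cancel_left₀ hb.ne', inv_mul_le_iff₀ hN, mul_comm X]

theorem mem_coneVectors_iff {z : ClassGroup (𝓞 K) × NonzeroVec n K} {b : (Ideal (𝓞 K))⁰}
    (h : scalingUnit w z.2 = classRep z.1 * FractionalIdeal.mk0 K b) (X : ℝ) :
    z ∈ coneVectors w X ↔ InCone w z.2.1 ∧
      (Ideal.absNorm (b : Ideal (𝓞 K)) : ℝ) * size w (Quotient.mk (orbitSetoid w K) z.2) ≤ X := by
  rw [absNorm_mul_size_le_iff h]
  exact ⟨fun hz => hz.2, fun hz => ⟨forall_mem_classRep_pow h, hz⟩⟩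

theorem toPair_mem {X : ℝ} {z : ClassGroup (𝓞 K) × NonzeroVec n K} (hz : z ∈ coneVectors w X) :
    toPair w z ∈ idealPointPairs w X :=
  ((mem_coneVectors_iff (scalingUnit_eq_classRep_mul hz.1) X).mp hz).2

theorem exists_toPair_eq {X : ℝ} {b : (Ideal (𝓞 K))⁰} (y : NonzeroVec n K)
    (h : (b, Quotient.mk (orbitSetoid w K) y) ∈ idealPointPairs w X) :
    ∃ (C : ClassGroup (𝓞 K)) (c : Kˣ), (C, weightedSMul w c y) ∈ coneVectors w X ∧
      toPair w (C, weightedSMul w c y) = (b, Quotient.mk (orbitSetoid w K) y) := by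
  -- The class is forced to be that of the scaling ideal divided by `b`, and `c` adjusts the scaling
  -- ideal to `classRep C * b`. The unit `u` then moves the vector into the cone without changing
  -- any ideal.
  obtain ⟨C, c, hc⟩ := exists_classRep_eq (scalingUnit w y * (FractionalIdeal.mk0 K b)⁻¹)
  obtain ⟨u, hu⟩ := exists_unit_inCone w (weightedSMul w c y)
  have hmul : weightedSMul w (unitToField u) (weightedSMul w c y) =
      weightedSMul w (unitToField u * c) y := by
    ext i
    simp only [weightedSMul_apply, Units.val_mul, mul_pow, mul_assoc]
  have hs : scalingUnit w (weightedSMul w (unitToField u * c) y) =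
      classRep C * FractionalIdeal.mk0 K b := by
    rw [hc, ← hmul, scalingUnit_weightedSMul, scalingUnit_weightedSMul,
      toPrincipalIdeal_unitToField, one_mul, mul_assoc, mul_assoc, inv_mul_cancel, mul_one]
  refine ⟨C, unitToField u * c, ?_, ?_⟩
  · rw [mem_coneVectors_iff (z := (C, weightedSMul w (unitToField u * c) y)) hs, ← hmul]
    refine ⟨hu, ?_⟩
    rw [mk_weightedSMul, mk_weightedSMul]
    exact h
  · exact Prod.ext (scalingQuotient_eq hs) (mk_weightedSMul w _ y)

theorem weightedSMul_torsion_mem {X : ℝ} {C : ClassGroup (𝓞 K)} {x : NonzeroVec n K}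
    (hz : (C, x) ∈ coneVectors w X) {u : (𝓞 K)ˣ} (hu : u ∈ torsion K) :
    (C, weightedSMul w (unitToField u) x) ∈ coneVectors w X ∧
      toPair w (C, weightedSMul w (unitToField u) x) = toPair w (C, x) := by
  have hs := scalingUnit_eq_classRep_mul hz.1
  have hs' : scalingUnit w (weightedSMul w (unitToField u) x) =
      classRep C * FractionalIdeal.mk0 K (scalingQuotient w (C, x)) := by
    rw [scalingUnit_weightedSMul, toPrincipalIdeal_unitToField, one_mul]
    exact hs
  refine ⟨?_, Prod.ext (scalingQuotient_eq hs') (mk_weightedSMul w _ x)⟩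
  rw [mem_coneVectors_iff (z := (C, weightedSMul w (unitToField u) x)) hs',
    inCone_weightedSMul_iff_mem_torsion w hz.2.1, mk_weightedSMul]
  exact ⟨hu, ((mem_coneVectors_iff hs X).mp hz).2⟩

/-- The two vectors differ by some `c` in `Kˣ`. Equality of the integral ideals makes the two class
representatives differ by the ideal of `c`, so the classes agree and `c` is a unit; a unit linking
two vectors in the cone is a root of unity. -/
theorem exists_torsion_of_toPair_eq {X : ℝ} {z z' : ClassGroup (𝓞 K) × NonzeroVec n K}
    (hz : z ∈ coneVectors w X) (hz' : z' ∈ coneVectors w X) (h : toPair w z' = toPair w z) :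
    ∃ u ∈ torsion K, z' = (z.1, weightedSMul w (unitToField u) z.2) := by
  obtain ⟨C, x⟩ := z
  obtain ⟨C', x'⟩ := z'
  obtain ⟨h1, h2⟩ := Prod.ext_iff.mp h
  obtain ⟨c, rfl⟩ := exists_eq_weightedSMul h2.symm
  have hs := scalingUnit_eq_classRep_mul hz.1
  have hs' := scalingUnit_eq_classRep_mul hz'.1
  change scalingQuotient w _ = scalingQuotient w _ at h1
  rw [h1, scalingUnit_weightedSMul, hs, ← mul_assoc] at hs'
  have hC := mul_right_cancel hs'
  have hCC : C' = C := classRep_eq_of_mul hC.symm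
  subst hCC
  obtain ⟨u, rfl⟩ := exists_unit_of_toPrincipalIdeal_eq_one (mul_eq_right.mp hC)
  exact ⟨u, (inCone_weightedSMul_iff_mem_torsion w hz.2.1 u).mp hz'.2.1, rfl⟩

theorem toPair_image_coneVectors (X : ℝ) :
    (toPair w '' coneVectors w X : Set ((Ideal (𝓞 K))⁰ × Point w K)) = idealPointPairs w X := by
  ext ⟨b, p⟩
  constructor
  · rintro ⟨z, hz, h⟩
    rw [← h]
    exact toPair_mem hz
  · intro h
    induction p using Quotient.inductionOn with
    | h y =>
      obtain ⟨C, c, h1, h2⟩ := exists_toPair_eq y h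
      exact ⟨_, h1, h2⟩

variable (w)

/-- With no zero coordinate, `u` and `v` act alike exactly when `(u / v) ^ w i = 1` for all `i`,
that is `u ^ g = v ^ g` for the gcd `g` of the weights. The orbit thus matches the image of the
`g`-th power map on a cyclic group. -/
theorem ncard_range_weightedSMul_torsion {x : NonzeroVec n K} (hx : ∀ i, x.1 i ≠ 0) :
    (Set.range fun u : torsion K => weightedSMul w (unitToField (u : (𝓞 K)ˣ)) x).ncard =
      rootFactor w K := by
  set g := Finset.univ.gcd fun i => (w i : ℕ) with hg
  have hinj : ∀ u v : torsion K, weightedSMul w (unitToField (u : (𝓞 K)ˣ)) x =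
      weightedSMul w (unitToField (v : (𝓞 K)ˣ)) x ↔ u ^ g = v ^ g := by
    intro u v
    have h1 : weightedSMul w (unitToField (u : (𝓞 K)ˣ)) x =
        weightedSMul w (unitToField (v : (𝓞 K)ˣ)) x ↔ ∀ i, (u / v) ^ (w i : ℕ) = 1 := by
      rw [Subtype.ext_iff, funext_iff]
      refine forall_congr' fun i => ?_
      rw [weightedSMul_apply, weightedSMul_apply, mul_left_inj' (hx i), div_pow, div_eq_one,
        ← Units.val_pow_eq_pow_val, ← Units.val_pow_eq_pow_val, Units.val_inj, unitToField,
        unitToField, ← map_pow, ← map_pow]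
      have hi : Function.Injective (Units.map ((algebraMap (𝓞 K) K : 𝓞 K →+* K) : 𝓞 K →* K)) :=
        Units.map_injective (FaithfulSMul.algebraMap_injective (𝓞 K) K)
      exact hi.eq_iff.trans
        (Subtype.ext_iff (a1 := u ^ (w i : ℕ)) (a2 := v ^ (w i : ℕ))).symm
    rw [h1]
    simp_rw [← orderOf_dvd_iff_pow_eq_one]
    rw [← div_eq_one, ← div_pow, ← orderOf_dvd_iff_pow_eq_one, hg, Finset.dvd_gcd_iff]
    simp
  have hcard : (Set.range fun u : torsion K => weightedSMul w (unitToField (u : (𝓞 K)ˣ)) x).ncard =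
      Nat.card (powMonoidHom g : torsion K →* torsion K).range := by
    rw [← Nat.card_coe_set_eq]
    refine Nat.card_eq_of_bijective (fun y => ⟨y.2.choose ^ g, y.2.choose, rfl⟩) ⟨?_, ?_⟩
    · intro y y' h
      have := (hinj _ _).mpr (Subtype.ext_iff.mp h)
      exact Subtype.ext (y.2.choose_spec.symm.trans (this.trans y'.2.choose_spec))
    · rintro ⟨_, u, rfl⟩
      let y : Set.range fun u : torsion K => weightedSMul w (unitToField (u : (𝓞 K)ˣ)) x :=
        ⟨_, u, rfl⟩
      exact ⟨y, Subtype.ext ((hinj _ _).mp y.2.choose_spec)⟩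
  rw [hcard, IsCyclic.card_powMonoidHom_range, rootFactor, torsionOrder, Nat.gcd_comm]

/-- The number of elements of `coneVectors` with a given property. -/
theorem ncard_coneVectors (X : ℝ) (Q : (Fin (n + 1) → K) → Prop) :
    {z : ClassGroup (𝓞 K) × NonzeroVec n K | z ∈ coneVectors w X ∧ Q z.2.1}.Finite ∧
    {z : ClassGroup (𝓞 K) × NonzeroVec n K | z ∈ coneVectors w X ∧ Q z.2.1}.ncard =
      ∑ C : ClassGroup (𝓞 K), {x | x ∈ coneTuples w (classRep C) X ∧ Q x}.ncard := by
  have hfin : ∀ C : ClassGroup (𝓞 K), {x | x ∈ coneTuples w (classRep C) X ∧ Q x}.Finite :=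
    fun C => (finite_coneTuples w (classRep C) X).subset fun x hx => hx.1
  -- The zero vector has vanishing weighted norms, whereas elements of the cone have positive norm.
  have hne : ∀ {C : ClassGroup (𝓞 K)} {x : Fin (n + 1) → K},
      x ∈ coneTuples w (classRep C) X → x ≠ 0 := by
    rintro C _ h rfl
    have h1 := norm_pos_of_mem h.2.1
    rw [norm_mixedSpaceOfRealSpace (weightedNorm_nonneg w _)] at h1
    refine h1.ne' (Finset.prod_eq_zero (Finset.mem_univ (Classical.arbitrary _))
      (pow_eq_zero_iff (mult_pos).ne' |>.mpr ?_))
    simp [weightedNorm, tupleEmbedding]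
  let e : {z : ClassGroup (𝓞 K) × NonzeroVec n K | z ∈ coneVectors w X ∧ Q z.2.1} ≃
      Σ C : ClassGroup (𝓞 K), {x | x ∈ coneTuples w (classRep C) X ∧ Q x} :=
    { toFun := fun z => ⟨z.1.1, z.1.2.1, z.2⟩
      invFun := fun y => ⟨(y.1, ⟨y.2.1, hne y.2.2.1⟩), y.2.2⟩
      left_inv := fun z => rfl
      right_inv := fun y => rfl }
  have := fun C => (hfin C).to_subtype
  refine ⟨Set.finite_coe_iff.mp (Finite.of_equiv _ e.symm), ?_⟩
  · rw [← Nat.card_coe_set_eq, Nat.card_congr e, Nat.card_sigma]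
    rfl

theorem finite_coneVectors (X : ℝ) : (coneVectors w X : Set (ClassGroup (𝓞 K) × _)).Finite := by
  simpa using (ncard_coneVectors w X (K := K) fun _ => True).1

theorem finite_idealPointPairs (X : ℝ) :
    (idealPointPairs w X : Set ((Ideal (𝓞 K))⁰ × _)).Finite := by
  rw [← toPair_image_coneVectors]
  exact (finite_coneVectors w X).image _

/-- The fibres of `toPair` are orbits of roots of unity, all of the same size away from the
coordinate hyperplanes. -/
theorem ncard_coneVectors_ne_zero (X : ℝ) :
    {z : ClassGroup (𝓞 K) × NonzeroVec n K |
      z ∈ coneVectors w X ∧ ∀ i, z.2.1 i ≠ 0}.ncard = rootFactor w K *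
      (toPair w '' {z : ClassGroup (𝓞 K) × NonzeroVec n K |
        z ∈ coneVectors w X ∧ ∀ i, z.2.1 i ≠ 0}).ncard := by
  have hfin := (ncard_coneVectors w X (K := K) fun x => ∀ i, x i ≠ 0).1
  rw [Set.ncard_eq_toFinset_card _ hfin, Finset.card_eq_sum_card_image (toPair w)]
  rw [Finset.sum_congr rfl (g := fun _ => rootFactor w K), Finset.sum_const, smul_eq_mul, mul_comm]
  · rw [← Set.ncard_coe_finset, Finset.coe_image, hfin.coe_toFinset]
  · intro q hq
    obtain ⟨z, hz, rfl⟩ := Finset.mem_image.mp hq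
    rw [hfin.mem_toFinset] at hz
    rw [← ncard_range_weightedSMul_torsion w hz.2, ← Set.ncard_coe_finset,
      ← Set.ncard_image_of_injective (Set.range _) (Prod.mk_right_injective z.1)]
    refine congrArg Set.ncard (Set.ext fun z' => ?_)
    rw [Finset.coe_filter, Set.mem_ofPred_eq, hfin.mem_toFinset, Set.mem_image]
    constructor
    · rintro ⟨h1, h2⟩
      obtain ⟨u, hu, h⟩ := exists_torsion_of_toPair_eq hz.1 h1.1 h2
      exact ⟨_, ⟨⟨u, hu⟩, rfl⟩, h.symm⟩
    · rintro ⟨_, ⟨u, rfl⟩, rfl⟩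
      obtain ⟨h1, h2⟩ := weightedSMul_torsion_mem (C := z.1) (x := z.2) hz.1 u.2
      refine ⟨⟨h1, fun i => ?_⟩, h2⟩
      rw [weightedSMul_apply]
      exact mul_ne_zero (pow_ne_zero _ (Units.ne_zero _)) (hz.2 i)

theorem rootFactor_pos (K : Type*) [Field K] [NumberField K] : 0 < rootFactor w K :=
  Nat.div_pos (Nat.gcd_le_right _ (torsionOrder_pos K))
    (Nat.gcd_pos_of_pos_right _ (torsionOrder_pos K))

/-- A squeeze: with `A` all cone vectors, `Z j` those with `j`-th coordinate zero and `r` the root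
factor, the number of pairs lies between `(#A - ∑ #Z j) / r` and `#A / r + ∑ #Z j`, and the `Z j`
are of lower order. -/
theorem tendsto_ncard_idealPointPairs :
    Tendsto (fun X : ℝ =>
        ((idealPointPairs w X : Set ((Ideal (𝓞 K))⁰ × _)).ncard : ℝ) / X ^ weightSum w) atTop
      (𝓝 (classNumber K * coneLimit w K / rootFactor w K)) := by
  have hrf : (0 : ℝ) < rootFactor w K := by exact_mod_cast rootFactor_pos w K
  set A : ℝ → Set (ClassGroup (𝓞 K) × NonzeroVec n K) := fun X => coneVectors w X with hA
  set Z : Fin (n + 1) → ℝ → Set (ClassGroup (𝓞 K) × NonzeroVec n K) :=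
    fun j X => {z | z ∈ coneVectors w X ∧ z.2.1 j = 0} with hZ
  set N : ℝ → Set (ClassGroup (𝓞 K) × NonzeroVec n K) :=
    fun X => {z | z ∈ coneVectors w X ∧ ∀ i, z.2.1 i ≠ 0} with hN
  have hAlim : Tendsto (fun X => ((A X).ncard : ℝ) / X ^ weightSum w) atTop
      (𝓝 (classNumber K * coneLimit w K)) := by
    have h1 : ∀ X, (A X).ncard =
        ∑ C : ClassGroup (𝓞 K), (coneTuples w (classRep C) X).ncard := fun X => by
      simpa using (ncard_coneVectors w X (K := K) fun _ => True).2
    simp_rw [h1, Nat.cast_sum, Finset.sum_div]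
    have := tendsto_finsetSum Finset.univ
      fun (C : ClassGroup (𝓞 K)) _ => tendsto_ncard_coneTuples w (classRep C)
    rwa [Finset.sum_const, Finset.card_univ, nsmul_eq_mul] at this
  have hZlim : Tendsto (fun X => ∑ j, ((Z j X).ncard : ℝ) / X ^ weightSum w) atTop (𝓝 0) := by
    have h1 : ∀ j X, (Z j X).ncard =
        ∑ C : ClassGroup (𝓞 K),
          {x : Fin (n + 1) → K | x ∈ coneTuples w (classRep C) X ∧ x j = 0}.ncard :=
      fun j X => (ncard_coneVectors w X (K := K) fun x => x j = 0).2
    simp_rw [h1, Nat.cast_sum, Finset.sum_div]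
    have := tendsto_finsetSum Finset.univ fun (j : Fin (n + 1)) _ =>
      tendsto_finsetSum Finset.univ
        fun (C : ClassGroup (𝓞 K)) _ => tendsto_ncard_coneTuples_eq_zero w (classRep C) j
    simpa using this
  have hsplit : ∀ X, A X ⊆ N X ∪ ⋃ j, Z j X := by
    intro X z hz
    by_cases h : ∀ i, z.2.1 i ≠ 0
    · exact Or.inl ⟨hz, h⟩
    · push Not at h
      obtain ⟨j, hj⟩ := h
      exact Or.inr (Set.mem_iUnion.mpr ⟨j, hz, hj⟩)
  have hAfin : ∀ X, (A X).Finite := finite_coneVectors w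
  have hUnion : ∀ X, (⋃ j, Z j X).ncard ≤ ∑ j, (Z j X).ncard := fun X => by
    simpa using Finset.set_ncard_biUnion_le Finset.univ fun j => Z j X
  have hUfin : ∀ X, (⋃ j, Z j X).Finite := fun X =>
    Set.finite_iUnion fun j => (hAfin X).subset fun z hz => hz.1
  have hNfin : ∀ X, (N X).Finite := fun X => (hAfin X).subset fun z hz => hz.1
  have hNcard : ∀ X, ((N X).ncard : ℝ) = rootFactor w K * ((toPair w '' N X).ncard : ℝ) :=
    fun X => by exact_mod_cast ncard_coneVectors_ne_zero w X
  have hlow : ∀ X, ((A X).ncard : ℝ) ≤ (N X).ncard + ∑ j, ((Z j X).ncard : ℝ) := fun X => by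
    have h1 := Set.ncard_le_ncard (hsplit X) ((hNfin X).union (hUfin X))
    have h2 := Set.ncard_union_le (N X) (⋃ j, Z j X)
    exact_mod_cast h1.trans (h2.trans (Nat.add_le_add_left (hUnion X) _))
  have hNle : ∀ X, ((N X).ncard : ℝ) ≤ (A X).ncard := fun X => by
    exact_mod_cast Set.ncard_le_ncard (fun z (hz : z ∈ N X) => hz.1) (hAfin X)
  have hPlow : ∀ X, ((toPair w '' N X).ncard : ℝ) ≤
      (idealPointPairs w X : Set ((Ideal (𝓞 K))⁰ × Point w K)).ncard := fun X => by
    rw [← toPair_image_coneVectors]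
    exact_mod_cast Set.ncard_le_ncard (Set.image_mono fun z (hz : z ∈ N X) => hz.1)
      ((hAfin X).image _)
  have hPup : ∀ X, ((idealPointPairs w X : Set ((Ideal (𝓞 K))⁰ × _)).ncard : ℝ) ≤
      (toPair w '' N X).ncard + ∑ j, ((Z j X).ncard : ℝ) := fun X => by
    rw [← toPair_image_coneVectors]
    have h1 := Set.ncard_le_ncard (Set.image_mono (f := toPair w) (hsplit X))
      (((hNfin X).union (hUfin X)).image _)
    rw [Set.image_union] at h1
    have h2 := Set.ncard_union_le (toPair w '' N X) (toPair w '' ⋃ j, Z j X)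
    have h3 := (Set.ncard_image_le (f := toPair w) (hUfin X)).trans (hUnion X)
    exact_mod_cast h1.trans (h2.trans (Nat.add_le_add_left h3 _))
  have hlim1 := (hAlim.sub hZlim).div_const (rootFactor w K : ℝ)
  have hlim2 := (hAlim.div_const (rootFactor w K : ℝ)).add hZlim
  rw [sub_zero] at hlim1
  rw [add_zero] at hlim2
  refine tendsto_of_tendsto_of_tendsto_of_le_of_le' hlim1 hlim2 ?_ ?_
  · filter_upwards [eventually_gt_atTop 0] with X hX
    have hXk : 0 < X ^ weightSum w := by positivity
    rw [← Finset.sum_div, ← sub_div, div_right_comm]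
    gcongr
    rw [div_le_iff₀' hrf]
    have := mul_le_mul_of_nonneg_left (hPlow X) hrf.le
    linarith [hlow X, hNcard X]
  · filter_upwards [eventually_gt_atTop 0] with X hX
    have hXk : 0 < X ^ weightSum w := by positivity
    rw [← Finset.sum_div, div_right_comm, ← add_div]
    gcongr
    refine (hPup X).trans (add_le_add_left ?_ _)
    rw [le_div_iff₀' hrf]
    linarith [hNle X, hNcard X]

end PairCount

/-! ### Cancellation of Möbius sums -/

section Moebius

open UniqueFactorizationMonoid
open scoped Classical

variable {α : Type*} [CommMonoidWithZero α] [UniqueFactorizationMonoid α]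

theorem abs_moebius_le_one (a : α) : |((moebius a : ℤ) : ℝ)| ≤ 1 := by
  by_cases h : Squarefree a
  · simp [h.moebius_eq]
  · simp [moebius_of_not_squarefree h]

theorem moebius_irreducible_mul {p b : α} (hp : Irreducible p) (hb : ¬ p ∣ b) :
    moebius (p * b) = -moebius b := by
  rw [(hp.isRelPrime_iff_not_dvd.mpr hb).moebius_mul, hp.moebius_eq, neg_one_mul]

variable [Subsingleton αˣ]

/-- Fix an irreducible `p` dividing `d`. Moving one factor `p` from one component to the other is a
sign-reversing involution on the factorisations with squarefree first component; the others
contribute zero. -/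
theorem sum_moebius_of_mul_eq {d : α} (hd0 : d ≠ 0) (hd : d ≠ 1) {F : Finset (α × α)}
    (hF : ∀ q, q ∈ F ↔ q.1 * q.2 = d) : ∑ q ∈ F, moebius q.1 = 0 := by
  obtain ⟨p, hp, hpd⟩ := WfDvdMonoid.exists_irreducible_factor
    (fun h => hd (isUnit_iff_eq_one.mp h)) hd0
  have hp0 := hp.ne_zero
  let dv : α → α := fun x => if h : p ∣ x then h.choose else x
  have hdv : ∀ x, p ∣ x → p * dv x = x := fun x h => by
    simp only [dv, dif_pos h]
    exact h.choose_spec.symm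
  have hdv' : ∀ x, dv (p * x) = x := fun x =>
    mul_left_cancel₀ hp0 (hdv _ (dvd_mul_right p x))
  let g : α × α → α × α := fun q => if p ∣ q.1 then (dv q.1, p * q.2) else (p * q.1, dv q.2)
  have hsf : ∀ x, Squarefree (p * x) → ¬ p ∣ x := fun x hx h =>
    hp.not_isUnit (hx p (mul_dvd_mul_left p h))
  have hsf' : ∀ x, Squarefree x → ¬ p ∣ x → Squarefree (p * x) := fun x hx h =>
    squarefree_mul_iff.mpr ⟨hp.isRelPrime_iff_not_dvd.mpr h, hp.squarefree, hx⟩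
  have hdvd : ∀ q ∈ F, ¬ p ∣ q.1 → p ∣ q.2 := fun q hq h => by
    rw [← (hF q).mp hq] at hpd
    exact (hp.prime.dvd_or_dvd hpd).resolve_left h
  have hg : ∀ q ∈ F.filter (fun q => Squarefree q.1),
      g q ∈ F.filter (fun q => Squarefree q.1) ∧ moebius (g q).1 = - moebius q.1 ∧
        g (g q) = q := by
    rintro ⟨b, c⟩ hq
    rw [Finset.mem_filter] at hq
    obtain ⟨hq, hsq⟩ := hq
    by_cases h : p ∣ b
    · obtain ⟨y, rfl⟩ := h
      have hy := hsf y hsq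
      have e : g (p * y, c) = (y, p * c) := by
        simp only [g, if_pos (dvd_mul_right p y), hdv']
      rw [e, Finset.mem_filter]
      refine ⟨⟨?_, hsq.of_mul_right⟩, ?_, ?_⟩
      · rw [hF, ← (hF _).mp hq]
        exact (mul_left_comm _ _ _).trans (mul_assoc _ _ _).symm
      · change _ = - moebius (p * y)
        rw [moebius_irreducible_mul hp hy, neg_neg]
      · simp only [g, if_neg hy, hdv']
    · obtain ⟨y, rfl⟩ := hdvd _ hq h
      have e : g (b, p * y) = (p * b, y) := by
        simp only [g, if_neg h, hdv']
      rw [e, Finset.mem_filter]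
      refine ⟨⟨?_, hsf' b hsq h⟩, moebius_irreducible_mul hp h, ?_⟩
      · rw [hF, ← (hF _).mp hq]
        exact (mul_assoc _ _ _).trans (mul_left_comm _ _ _)
      · simp only [g, if_pos (dvd_mul_right p b), hdv']
  rw [← Finset.sum_filter_of_ne (p := fun q : α × α => Squarefree q.1)
    fun q _ h => by_contra fun h' => h (moebius_of_not_squarefree h')]
  refine Finset.sum_involution (fun q _ => g q) (fun q hq => ?_) (fun q hq h1 h2 => ?_)
    (fun q hq => (hg q hq).1) (fun q hq => (hg q hq).2.2)
  · rw [(hg q hq).2.1, add_neg_cancel]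
  · have := (hg q hq).2.1
    rw [h2] at this
    omega

end Moebius

/-! ### Asymptotics of sums by dominated convergence -/

section DominatedSums

open scoped Topology

/-- Each term divided by `X ^ k` converges, and the global bound on `F` dominates it by `C * (N i ^
k)⁻¹`, which is summable. -/
theorem tendsto_tsum_mul_comp_div {ι : Type*} {N : ι → ℝ} (hN : ∀ i, 0 < N i) {k : ℕ}
    (hs : Summable fun i => (N i ^ k)⁻¹) {a : ι → ℝ} (ha : ∀ i, |a i| ≤ 1) {F : ℝ → ℝ} {C m : ℝ}
    (hC : ∀ X, 0 < X → |F X| ≤ C * X ^ k) (hF : Tendsto (fun X => F X / X ^ k) atTop (𝓝 m)) :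
    Tendsto (fun X => (∑' i, a i * F (X / N i)) / X ^ k) atTop
      (𝓝 (m * ∑' i, a i * (N i ^ k)⁻¹)) := by
  simp_rw [← tsum_div_const, ← tsum_mul_left]
  refine tendsto_tsum_of_dominated_convergence (hs.mul_left C) (fun i => ?_) ?_
  · have h := (hF.comp (tendsto_id.atTop_div_const (hN i))).const_mul (a i * (N i ^ k)⁻¹)
    rw [mul_comm _ m] at h
    refine h.congr' ?_
    filter_upwards [eventually_gt_atTop 0] with X hX
    have := hN i
    simp only [Function.comp_apply, id, div_pow]
    field_simp
  · filter_upwards [eventually_gt_atTop 0] with X hX i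
    have hNi := hN i
    rw [Real.norm_eq_abs, abs_div, abs_mul, abs_of_pos (pow_pos hX k),
      div_le_iff₀ (pow_pos hX k)]
    calc |a i| * |F (X / N i)| ≤ 1 * (C * (X / N i) ^ k) :=
          mul_le_mul (ha i) (hC _ (div_pos hX hNi)) (abs_nonneg _) zero_le_one
      _ = C * (N i ^ k)⁻¹ * X ^ k := by rw [one_mul, div_pow]; ring

end DominatedSums

/-! ### The Dedekind zeta value as a sum over ideals -/

section Zeta

open NumberField.InfinitePlace NumberField.Units
open scoped Topology Classical

variable (K : Type*) [Field K] [NumberField K]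

/-- The number of ideals of norm at most `n` grows linearly, so the Dirichlet series converges at
every exponent above one. -/
theorem lSeriesSummable_card_ideal {k : ℕ} (hk : 2 ≤ k) :
    LSeriesSummable (fun n ↦ ((Nat.card {I : Ideal (𝓞 K) // Ideal.absNorm I = n} : ℝ) : ℂ)) k := by
  refine LSeriesSummable_of_sum_norm_bigO_and_nonneg (r := 1) ?_ (fun _ ↦ Nat.cast_nonneg _)
    zero_le_one (by simpa using (by exact_mod_cast hk : (1 : ℝ) < k))
  simp_rw [Real.rpow_one]
  have key : Tendsto (fun n : ℕ => (∑ i ∈ Finset.Icc 1 n,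
      (Nat.card {I : Ideal (𝓞 K) // Ideal.absNorm I = i} : ℝ)) / n) atTop
      (𝓝 (dedekindZeta_residue K)) := by
    refine ((Ideal.tendsto_norm_le_div_atTop₀ K).comp tendsto_natCast_atTop_atTop).congr fun n ↦ ?_
    simp only [Function.comp_apply, Nat.cast_le, ← Nat.cast_sum]
    congr
    -- The added `1` accounts for the zero ideal, which supplies the term of norm zero.
    rw [← add_left_inj 1, ← Ideal.card_norm_le_eq_card_norm_le_add_one,
      show Finset.Icc 1 n = Finset.Ioc 0 n from Finset.Icc_succ_left_eq_Ioc _ _,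
      show 1 = Nat.card {I : Ideal (𝓞 K) // Ideal.absNorm I = 0} by
        simp [Ideal.absNorm_eq_zero_iff],
      Finset.sum_Ioc_add_eq_sum_Icc (n.zero_le),
      ← Finset.card_preimage_eq_sum_card_image_eq
        (fun k _ ↦ Ideal.finite_setOfPred_absNorm_eq k)]
    simp [Set.coe_eq_subtype]
  refine isBigO_of_div_tendsto_nhds ?_ _ key
  filter_upwards [eventually_gt_atTop 0] with n hn h
  simp [hn.ne'] at h

/-- Group the ideals by norm: the fibres are finite, and nonnegativity turns convergence of the
grouped series into summability over ideals. -/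
theorem hasSum_absNorm_pow_inv {k : ℕ} (hk : 2 ≤ k) :
    HasSum (fun b : (Ideal (𝓞 K))⁰ => ((Ideal.absNorm (b : Ideal (𝓞 K)) : ℝ) ^ k)⁻¹)
      (zetaValue K k) := by
  set c : ℕ → ℝ := fun n => Nat.card {I : Ideal (𝓞 K) // Ideal.absNorm I = n} with hc
  have hk0 : k ≠ 0 := by omega
  have h1 : HasSum (fun n => c n * ((n : ℝ) ^ k)⁻¹) (zetaValue K k) := by
    have := Complex.hasSum_re (lSeriesSummable_card_ideal K hk).LSeriesHasSum
    refine this.congr_fun fun n => ?_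
    rcases eq_or_ne n 0 with rfl | hn
    · simp [hk0]
    · rw [LSeries.term_of_ne_zero hn, Complex.cpow_natCast]
      norm_cast
  let e := Equiv.sigmaFiberEquiv fun b : (Ideal (𝓞 K))⁰ => Ideal.absNorm (b : Ideal (𝓞 K))
  have hfin : ∀ n, Finite {b : (Ideal (𝓞 K))⁰ // Ideal.absNorm (b : Ideal (𝓞 K)) = n} := fun n =>
    ((Ideal.finite_setOfPred_absNorm_eq n).preimage Subtype.val_injective.injOn).to_subtype
  have hcard : ∀ n : ℕ, n ≠ 0 →
      (Nat.card {b : (Ideal (𝓞 K))⁰ // Ideal.absNorm (b : Ideal (𝓞 K)) = n} : ℝ) = c n := by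
    intro n hn
    rw [hc, Nat.cast_inj]
    refine Nat.card_congr
      { toFun := fun b => ⟨b.1, b.2⟩
        invFun := fun I => ⟨⟨I.1, mem_nonZeroDivisors_of_ne_zero fun h => hn ?_⟩, I.2⟩
        left_inv := fun b => rfl
        right_inv := fun b => rfl }
    rw [← I.2, h, Ideal.zero_eq_bot, Ideal.absNorm_bot]
  have hfib : ∀ n : ℕ, HasSum (fun b : {b : (Ideal (𝓞 K))⁰ //
      Ideal.absNorm (b : Ideal (𝓞 K)) = n} =>
        ((Ideal.absNorm ((e ⟨n, b⟩ : (Ideal (𝓞 K))⁰) : Ideal (𝓞 K)) : ℝ) ^ k)⁻¹)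
      (c n * ((n : ℝ) ^ k)⁻¹) := by
    intro n
    have := hfin n
    have := Fintype.ofFinite {b : (Ideal (𝓞 K))⁰ // Ideal.absNorm (b : Ideal (𝓞 K)) = n}
    convert! hasSum_fintype _ using 1
    rw [Finset.sum_congr rfl fun b _ => by
      rw [show ((e ⟨n, b⟩ : (Ideal (𝓞 K))⁰) : Ideal (𝓞 K)) = b.1.1 from rfl, b.2],
      Finset.sum_const, Finset.card_univ, ← Nat.card_eq_fintype_card, nsmul_eq_mul]
    rcases eq_or_ne n 0 with rfl | hn
    · simp [hk0]
    · rw [hcard n hn]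
  rw [← e.hasSum_iff]
  refine HasSum.sigma_of_hasSum h1 hfib ?_
  refine (summable_sigma_of_nonneg fun y => ?_).mpr ⟨fun n => (hfib n).summable, ?_⟩
  · simp only [Function.comp_apply]; positivity
  · exact h1.summable.congr fun n => (hfib n).tsum_eq.symm

theorem zetaValue_pos {k : ℕ} (hk : 2 ≤ k) : 0 < zetaValue K k := by
  have h := hasSum_absNorm_pow_inv K hk
  rw [← h.tsum_eq]
  exact h.summable.tsum_pos (fun b => by positivity) 1 (by simp)

end Zeta

/-! ### Möbius inversion over integral ideals -/

section Inversion

open UniqueFactorizationMonoid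
open scoped Topology Classical

variable {K : Type*} [Field K] [NumberField K]

/-- The norm of a nonzero integral ideal as a real number. -/
def realNorm (b : (Ideal (𝓞 K))⁰) : ℝ := Ideal.absNorm (b : Ideal (𝓞 K))

theorem one_le_realNorm (b : (Ideal (𝓞 K))⁰) : 1 ≤ realNorm b := by
  rw [realNorm]
  exact_mod_cast Ideal.absNorm_pos_of_nonZeroDivisors b

theorem realNorm_pos (b : (Ideal (𝓞 K))⁰) : 0 < realNorm b :=
  zero_lt_one.trans_le (one_le_realNorm b)

theorem realNorm_mul (b c : (Ideal (𝓞 K))⁰) : realNorm (b * c) = realNorm b * realNorm c := by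
  simp [realNorm]

theorem realNorm_one : realNorm (1 : (Ideal (𝓞 K))⁰) = 1 := by simp [realNorm]

theorem finite_realNorm_le (Y : ℝ) : {b : (Ideal (𝓞 K))⁰ | realNorm b ≤ Y}.Finite := by
  refine (Ideal.finite_setOfPred_absNorm_le₀ ⌊Y⌋₊).subset fun b hb => ?_
  exact Nat.le_floor hb

/-- The sum of `P (X / N b)` over all nonzero integral ideals `b`. -/
def idealSum (K : Type*) [Field K] [NumberField K] (P : ℝ → ℝ) (X : ℝ) : ℝ :=
  ∑' b : (Ideal (𝓞 K))⁰, P (X / realNorm b)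

theorem sum_moebius_ideal {d : (Ideal (𝓞 K))⁰} {F : Finset ((Ideal (𝓞 K))⁰ × (Ideal (𝓞 K))⁰)}
    (hF : ∀ q, q ∈ F ↔ q.1 * q.2 = d) :
    ∑ q ∈ F, moebius (q.1 : Ideal (𝓞 K)) = if d = 1 then 1 else 0 := by
  split_ifs with hd
  · have : F = {(1, 1)} := by
      ext ⟨b, c⟩
      rw [hF, hd, Finset.mem_singleton, Prod.mk.injEq]
      refine ⟨fun h => ?_, fun h => by simp [h.1, h.2]⟩
      have h' : (b : Ideal (𝓞 K)) * c = 1 := congrArg Subtype.val h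
      rw [mul_eq_one] at h'
      exact ⟨Subtype.ext h'.1, Subtype.ext h'.2⟩
    rw [this, Finset.sum_singleton, Submonoid.coe_one, moebius_one]
  · let φ : (Ideal (𝓞 K))⁰ × (Ideal (𝓞 K))⁰ ↪ Ideal (𝓞 K) × Ideal (𝓞 K) :=
      ⟨Prod.map Subtype.val Subtype.val, Subtype.val_injective.prodMap Subtype.val_injective⟩
    have h := sum_moebius_of_mul_eq (F := F.map φ) (nonZeroDivisors.ne_zero d.2)
      (fun h => hd (Subtype.ext h)) ?_
    · rw [Finset.sum_map] at h
      exact h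
    · rintro ⟨b, c⟩
      rw [Finset.mem_map]
      constructor
      · rintro ⟨q, hq, h⟩
        rw [hF] at hq
        rw [← h, ← hq]
        rfl
      · intro h
        have h0 : b * c ≠ 0 := fun h' => nonZeroDivisors.ne_zero d.2 (h.symm.trans h')
        refine ⟨(⟨b, mem_nonZeroDivisors_of_ne_zero (left_ne_zero_of_mul h0)⟩,
          ⟨c, mem_nonZeroDivisors_of_ne_zero (right_ne_zero_of_mul h0)⟩), ?_, rfl⟩
        rw [hF]
        exact Subtype.ext h

variable {P : ℝ → ℝ} {ε : ℝ}

theorem comp_div_eq_zero (hε : 0 < ε) (h0 : ∀ X, X < ε → P X = 0) {X Y : ℝ} (hXY : X ≤ Y)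
    {b : (Ideal (𝓞 K))⁰} (hb : ¬ realNorm b ≤ Y / ε) : P (X / realNorm b) = 0 := by
  refine h0 _ ?_
  rw [div_lt_iff₀ (realNorm_pos b), mul_comm]
  rw [not_le, div_lt_iff₀ hε] at hb
  exact hXY.trans_lt hb

theorem idealSum_eq_sum (hε : 0 < ε) (h0 : ∀ X, X < ε → P X = 0) {X Y : ℝ} (hXY : X ≤ Y) :
    idealSum K P X =
      ∑ b ∈ (finite_realNorm_le (K := K) (Y / ε)).toFinset, P (X / realNorm b) := by
  refine tsum_eq_sum fun b hb => comp_div_eq_zero hε h0 hXY ?_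
  rwa [Set.Finite.mem_toFinset] at hb

/-- As `P` vanishes below `ε`, only ideals of norm at most `X / ε` matter and all sums are finite.
Grouping by the product `d = b * c`, only `d = 1` survives. -/
theorem tsum_moebius_mul_idealSum (hε : 0 < ε) (h0 : ∀ X, X < ε → P X = 0) {X : ℝ} (hX : 0 < X) :
    ∑' b : (Ideal (𝓞 K))⁰, ((moebius (b : Ideal (𝓞 K)) : ℤ) : ℝ) *
      idealSum K P (X / realNorm b) = P X := by
  set S := (finite_realNorm_le (K := K) (X / ε)).toFinset with hS
  have hmem : ∀ b, b ∈ S ↔ realNorm b ≤ X / ε := fun b => Set.Finite.mem_toFinset _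
  have hle : ∀ b : (Ideal (𝓞 K))⁰, X / realNorm b ≤ X := fun b =>
    div_le_self hX.le (one_le_realNorm b)
  have hM : ∀ b : (Ideal (𝓞 K))⁰, idealSum K P (X / realNorm b) =
      ∑ c ∈ S, P (X / realNorm (b * c)) := fun b => by
    rw [idealSum_eq_sum hε h0 (hle b)]
    simp_rw [div_div, ← realNorm_mul, ← hS]
  have hmul : ∀ b c : (Ideal (𝓞 K))⁰, b * c ∈ S → b ∈ S ∧ c ∈ S := fun b c h => by
    rw [hmem, realNorm_mul] at h
    rw [hmem, hmem]
    exact ⟨(le_mul_of_one_le_right (realNorm_pos b).le (one_le_realNorm c)).trans h,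
      (le_mul_of_one_le_left (realNorm_pos c).le (one_le_realNorm b)).trans h⟩
  have hz : ∀ b, b ∉ S → P (X / realNorm b) = 0 := fun b hb =>
    comp_div_eq_zero hε h0 le_rfl fun h => hb ((hmem b).mpr h)
  rw [tsum_eq_sum (s := S)]
  · simp_rw [hM, Finset.mul_sum]
    rw [← Finset.sum_product', ← Finset.sum_filter_of_ne
      (p := fun q : (Ideal (𝓞 K))⁰ × (Ideal (𝓞 K))⁰ => q.1 * q.2 ∈ S)]
    · rw [← Finset.sum_fiberwise_of_maps_to (t := S)
        (g := fun q : (Ideal (𝓞 K))⁰ × (Ideal (𝓞 K))⁰ => q.1 * q.2)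
        fun q hq => (Finset.mem_filter.mp hq).2]
      have : ∀ d ∈ S, ∑ q ∈ ((S ×ˢ S).filter fun q => q.1 * q.2 ∈ S).filter
          (fun q => q.1 * q.2 = d), ((moebius (q.1 : Ideal (𝓞 K)) : ℤ) : ℝ) *
            P (X / realNorm (q.1 * q.2)) = if d = 1 then P X else 0 := by
        intro d hd
        rw [Finset.sum_congr rfl (g := fun q => ((moebius (q.1 : Ideal (𝓞 K)) : ℤ) : ℝ) *
          P (X / realNorm d)) fun q hq => by rw [(Finset.mem_filter.mp hq).2],
          ← Finset.sum_mul, ← Int.cast_sum, sum_moebius_ideal (d := d)]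
        · split_ifs with h
          · rw [h, realNorm_one, div_one, Int.cast_one, one_mul]
          · rw [Int.cast_zero, zero_mul]
        · intro q
          simp only [Finset.mem_filter, Finset.mem_product]
          exact ⟨fun h => h.2, fun h => ⟨⟨hmul _ _ (h ▸ hd), h ▸ hd⟩, h⟩⟩
      rw [Finset.sum_congr rfl this, Finset.sum_ite_eq']
      split_ifs with h
      · rfl
      · rw [← hz 1 h, realNorm_one, div_one]
    · intro q _ h
      by_contra hq
      exact h (by rw [hz _ hq, mul_zero])
  · intro b hb
    rw [hM, Finset.sum_eq_zero, mul_zero]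
    exact fun c _ => hz _ fun h => hb (hmul b c h).1

theorem le_idealSum (hε : 0 < ε) (h0 : ∀ X, X < ε → P X = 0) (hnn : ∀ X, 0 ≤ P X) (X : ℝ) :
    P X ≤ idealSum K P X := by
  by_cases h : X < ε
  · rw [h0 X h]
    exact tsum_nonneg fun b => hnn _
  · rw [idealSum_eq_sum hε h0 le_rfl]
    have h1 : (1 : (Ideal (𝓞 K))⁰) ∈ (finite_realNorm_le (K := K) (X / ε)).toFinset := by
      rw [Set.Finite.mem_toFinset, Set.mem_ofPred_eq, realNorm_one, one_le_div hε]
      exact not_lt.mp h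
    have := Finset.single_le_sum (f := fun b => P (X / realNorm b)) (fun b _ => hnn _) h1
    rwa [realNorm_one, div_one] at this

theorem idealSum_mono (hε : 0 < ε) (h0 : ∀ X, X < ε → P X = 0) (hP : Monotone P) :
    Monotone (idealSum K P) := by
  intro X Y hXY
  rw [idealSum_eq_sum hε h0 hXY, idealSum_eq_sum hε h0 le_rfl]
  exact Finset.sum_le_sum fun b _ => hP (div_le_div_of_nonneg_right hXY (realNorm_pos b).le)

/-- The limit controls large `X`, monotonicity the range from `ε` to `X₀`, and `M` is zero below
`ε`. Domination needs the bound at every positive argument. -/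
theorem exists_le_mul_pow {M : ℝ → ℝ} {k : ℕ} {m : ℝ} (hM : Monotone M) (hnn : ∀ X, 0 ≤ M X)
    (hε : 0 < ε) (h0 : ∀ X, X < ε → M X = 0)
    (hlim : Tendsto (fun X => M X / X ^ k) atTop (𝓝 m)) :
    ∃ C, ∀ X, 0 < X → M X ≤ C * X ^ k := by
  obtain ⟨X₀, hX₀⟩ := eventually_atTop.mp (hlim.eventually (gt_mem_nhds (lt_add_one m)))
  refine ⟨max (m + 1) (M X₀ / ε ^ k), fun X hX => ?_⟩
  have hXk : 0 < X ^ k := pow_pos hX k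
  rcases le_total X₀ X with h | h
  · exact ((div_lt_iff₀ hXk).mp (hX₀ X h)).le.trans
      (mul_le_mul_of_nonneg_right (le_max_left _ _) hXk.le)
  · refine le_trans ?_ (mul_le_mul_of_nonneg_right (le_max_right _ _) hXk.le)
    rcases lt_or_ge X ε with h' | h'
    · rw [h0 X h']
      have := hnn X₀
      positivity
    · calc M X ≤ M X₀ := hM h
        _ = M X₀ / ε ^ k * ε ^ k := by field_simp
        _ ≤ _ := mul_le_mul_of_nonneg_left (pow_le_pow_left₀ hε.le h' k)
          (div_nonneg (hnn _) (pow_pos hε k).le)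

variable (K) in
/-- If the sum of `P (X / N b)` over the nonzero integral ideals `b` is asymptotic to `m * X ^ k`,
then `P X` is asymptotic to `m / ζ_K(k) * X ^ k`. -/
theorem tendsto_div_zetaValue {k : ℕ} {m : ℝ} (hk : 2 ≤ k) (hP : Monotone P) (hnn : ∀ X, 0 ≤ P X)
    (hε : 0 < ε) (h0 : ∀ X, X < ε → P X = 0)
    (hlim : Tendsto (fun X => idealSum K P X / X ^ k) atTop (𝓝 m)) :
    Tendsto (fun X => P X / X ^ k) atTop (𝓝 (m / zetaValue K k)) := by
  have hζ := hasSum_absNorm_pow_inv K hk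
  have hs : Summable fun b : (Ideal (𝓞 K))⁰ => (realNorm b ^ k)⁻¹ := hζ.summable
  have hMnn : ∀ X, 0 ≤ idealSum K P X := fun X => tsum_nonneg fun b => hnn _
  have hM0 : ∀ X, X < ε → idealSum K P X = 0 := fun X hX => by
    refine (tsum_congr fun b => h0 _ ?_).trans tsum_zero
    rcases le_total X 0 with h | h
    · exact (div_nonpos_of_nonpos_of_nonneg h (realNorm_pos b).le).trans_lt hε
    · exact (div_le_self h (one_le_realNorm b)).trans_lt hX
  obtain ⟨C, hC⟩ := exists_le_mul_pow (idealSum_mono hε h0 hP) hMnn hε hM0 hlim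
  have h1 := tendsto_tsum_mul_comp_div realNorm_pos hs
    (fun b => abs_moebius_le_one (b : Ideal (𝓞 K)))
    (fun X hX => (abs_of_nonneg (hMnn X)).le.trans (hC X hX)) hlim
  set L := m * ∑' b : (Ideal (𝓞 K))⁰,
    ((moebius (b : Ideal (𝓞 K)) : ℤ) : ℝ) * (realNorm b ^ k)⁻¹ with hL
  have h2 : Tendsto (fun X => P X / X ^ k) atTop (𝓝 L) := by
    refine h1.congr' ?_
    filter_upwards [eventually_gt_atTop 0] with X hX
    rw [tsum_moebius_mul_idealSum hε h0 hX]
  -- The Möbius series in `L` need not be evaluated: now that `P X / X ^ k` is known to converge to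
  -- `L`, summing `P` back over the ideals gives `L * ζ_K(k)`, which must equal `m` by uniqueness of
  -- limits.
  have h3 := tendsto_tsum_mul_comp_div (a := fun _ : (Ideal (𝓞 K))⁰ => (1 : ℝ)) realNorm_pos hs
    (fun _ => by simp) (fun X hX => (abs_of_nonneg (hnn X)).le.trans
      ((le_idealSum (K := K) hε h0 hnn X).trans (hC X hX))) h2
  simp_rw [one_mul] at h3
  have h4 : m = L * zetaValue K k := by
    rw [← hζ.tsum_eq]
    exact tendsto_nhds_unique hlim h3
  rwa [h4, mul_div_cancel_right₀ _ (zetaValue_pos K hk).ne']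

end Inversion

/-! ### From pairs back to points -/

section PointCount

open NumberField.InfinitePlace NumberField.Units
open scoped Topology Classical

variable {n : ℕ} (w : Fin (n + 1) → ℕ+) (K : Type*) [Field K] [NumberField K]

/-- The number of points of size at most `T`. -/
def pointCount (T : ℝ) : ℕ := {x : Point w K | size w x ≤ T}.ncard

/-- The points embed as the slice `b = 1` of the finite set of pairs. -/
theorem finite_size_le (T : ℝ) : {x : Point w K | size w x ≤ T}.Finite := by
  refine Set.Finite.of_finite_image (f := Prod.mk (1 : (Ideal (𝓞 K))⁰))
    ((finite_idealPointPairs w T).subset ?_) (Prod.mk_right_injective _).injOn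
  rintro _ ⟨p, hp, rfl⟩
  change ((Ideal.absNorm ((1 : (Ideal (𝓞 K))⁰) : Ideal (𝓞 K)) : ℕ) : ℝ) * size w p ≤ T
  rw [Submonoid.coe_one, map_one, Nat.cast_one, one_mul]
  exact hp

theorem monotone_pointCount : Monotone fun T => (pointCount w K T : ℝ) := fun _ T h =>
  Nat.cast_le.mpr (Set.ncard_le_ncard (fun _ hx => le_trans hx h) (finite_size_le w K T))

/-- Finitely many points have size at most `1` and all sizes are positive, so the smallest size
serves as `ε`, or `1` if there are no such points. -/
theorem exists_forall_lt_pointCount_eq_zero :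
    ∃ ε > 0, ∀ T < ε, (pointCount w K T : ℝ) = 0 := by
  rcases (finite_size_le w K 1).toFinset.eq_empty_or_nonempty with h | h
  · refine ⟨1, one_pos, fun T hT => ?_⟩
    rw [Set.Finite.toFinset_eq_empty] at h
    have := monotone_pointCount w K hT.le
    simp only [pointCount, h, Set.ncard_empty] at this
    exact le_antisymm (by simpa [pointCount] using this) (Nat.cast_nonneg _)
  · obtain ⟨p, hp, hmin⟩ := Finset.exists_min_image _ (size w) h
    rw [Set.Finite.mem_toFinset] at hp
    refine ⟨size w p, size_pos w p, fun T hT => ?_⟩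
    rw [pointCount, Set.eq_empty_of_forall_notMem (s := {x : Point w K | size w x ≤ T}),
      Set.ncard_empty, Nat.cast_zero]
    intro q (hq : size w q ≤ T)
    refine (hmin q ?_).not_gt (hq.trans_lt hT)
    rw [Set.Finite.mem_toFinset]
    exact (hq.trans hT.le).trans hp

theorem ncard_idealPointPairs (X : ℝ) :
    ((idealPointPairs w X : Set ((Ideal (𝓞 K))⁰ × Point w K)).ncard : ℝ) =
      idealSum K (fun T => (pointCount w K T : ℝ)) X := by
  obtain ⟨ε, hε, h0⟩ := exists_forall_lt_pointCount_eq_zero w K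
  rw [idealSum_eq_sum hε h0 le_rfl]
  set S := (finite_realNorm_le (K := K) (X / ε)).toFinset
  have hfin := finite_idealPointPairs w (K := K) X
  have hmem : ∀ (b : (Ideal (𝓞 K))⁰) (p : Point w K),
      (b, p) ∈ idealPointPairs w X ↔ size w p ≤ X / realNorm b := fun b p => by
    rw [le_div_iff₀' (realNorm_pos b)]
    rfl
  rw [Set.ncard_eq_toFinset_card _ hfin, Finset.card_eq_sum_card_fiberwise (f := Prod.fst) (t := S),
    Nat.cast_sum]
  · refine Finset.sum_congr rfl fun b _ => ?_
    rw [pointCount, Nat.cast_inj, ← Set.ncard_coe_finset,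
      ← Set.ncard_image_of_injective {x : Point w K | _} (Prod.mk_right_injective b)]
    refine congrArg Set.ncard (Set.ext fun ⟨c, p⟩ => ?_)
    rw [Finset.coe_filter, Set.mem_ofPred_eq, hfin.mem_toFinset, Set.mem_image]
    constructor
    · rintro ⟨h1, rfl⟩
      exact ⟨p, (hmem _ p).mp h1, rfl⟩
    · rintro ⟨p', h1, h2⟩
      obtain ⟨rfl, rfl⟩ := Prod.ext_iff.mp h2
      exact ⟨(hmem _ _).mpr h1, rfl⟩
  -- An ideal of norm above `X / ε` admits no point, because `X / N(b)` is then below `ε`.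
  · rintro ⟨b, p⟩ h
    rw [Finset.mem_coe, hfin.mem_toFinset, hmem] at h
    rw [Finset.mem_coe, Set.Finite.mem_toFinset]
    by_contra hb
    have h1 := comp_div_eq_zero hε h0 le_rfl hb
    rw [pointCount, Nat.cast_eq_zero, Set.ncard_eq_zero (finite_size_le w K _)] at h1
    exact (Set.eq_empty_iff_forall_notMem.mp h1) p h

theorem countConst_eq :
    countConst w K =
      classNumber K * coneLimit w K / rootFactor w K / zetaValue K (weightSum w) := by
  rw [countConst, coneLimit, Units.rank, card_eq_nrRealPlaces_add_nrComplexPlaces]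
  ring

theorem countConst_pos (hw : 2 ≤ weightSum w) : 0 < countConst w K := by
  have h1 : (0 : ℝ) < classNumber K := by exact_mod_cast classNumber_pos K
  have h2 := regulator_pos K
  have h3 : (0 : ℝ) < rootFactor w K := by exact_mod_cast rootFactor_pos w K
  have h4 := zetaValue_pos K hw
  have h5 : (0 : ℝ) < √|(discr K : ℝ)| :=
    Real.sqrt_pos.mpr (abs_pos.mpr (Int.cast_ne_zero.mpr (discr_ne_zero K)))
  have h6 : (0 : ℝ) < weightSum w := by exact_mod_cast weightSum_pos w
  have := Real.pi_pos
  rw [countConst]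
  positivity

theorem tendsto_pointCount (hw : 2 ≤ weightSum w) :
    Tendsto (fun T => (pointCount w K T : ℝ) / T ^ weightSum w) atTop (𝓝 (countConst w K)) := by
  obtain ⟨ε, hε, h0⟩ := exists_forall_lt_pointCount_eq_zero w K
  rw [countConst_eq]
  refine tendsto_div_zetaValue K hw (monotone_pointCount w K) (fun _ => Nat.cast_nonneg _) hε h0 ?_
  simp_rw [← ncard_idealPointPairs]
  exact tendsto_ncard_idealPointPairs w

end PointCount

end WeightedProjective

end

theorem theorem3 (n : ℕ) (w : Fin (n + 1) → ℕ+) (K : Type*) [Field K] [NumberField K]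
    (hw : 2 ≤ WeightedProjective.weightSum w) :
    (∀ T : ℝ, {x : WeightedProjective.Point w K | WeightedProjective.size w x ≤ T}.Finite) ∧
      (fun T : ℝ =>
          (({x : WeightedProjective.Point w K | WeightedProjective.size w x ≤ T}.ncard : ℕ) : ℝ))
        ~[atTop]
        (fun T : ℝ =>
          WeightedProjective.countConst w K * T ^ WeightedProjective.weightSum w) := by
  refine ⟨WeightedProjective.finite_size_le w K, ?_⟩
  have hC := (WeightedProjective.countConst_pos w K hw).ne'
  refine isEquivalent_of_tendsto_one ?_
  have h := (WeightedProjective.tendsto_pointCount w K hw).div_const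
    (WeightedProjective.countConst w K)
  rw [div_self hC] at h
  refine h.congr fun T => ?_
  rw [Pi.div_apply, div_div, mul_comm (T ^ _)]
  rfl
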